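/- **Theorem 1.3.** Let $\Gamma$ be a finite, undirected, connected graph without loops or multiple edges, with vertex set $X$, path-length distance $\partial$ and diameter $D\ge 3$. Assume that $\Gamma$ is distance-regular: for $0\le h,i,j\le D$ and $y,z\in X$ with $\partial(y,z)=h$, the number $|\{w\in X:\partial(y,w)=i,\ \partial(z,w)=j\}|$ depends only on $h,i,j$. Let $A$ be the adjacency matrix of $\Gamma$. It has exactly $D+1$ distinct eigenvalues $\theta_0,\dots,\theta_D$, ordered with $\theta_0$ equal to the valency of $\Gamma$; let $E_i$ be the primitive idempotent of $A$ for $\theta_i$, that is, the matrix that acts as the identity on the $\theta_i$-eigenspace of $A$ and as zero on the other eigenspaces. Assume that the ordering $\{E_i\}_{i=0}^D$ is $Q$-polynomial: writing the entrywise products as $E_i\circ E_j=|X|^{-1}\sum_{h=0}^D q^h_{i,j}E_h$, for all $0\le h,i,j\le D$ one has $q^h_{i,j}=0$ if one of $h,i,j$ is greater than the sum of the other two, and $q^h_{i,j}\ne 0$ if one of $h,i,j$ is equal to the sum of the other two. Fix a vertex $x\in X$. For $\mathbb F\in\{\mathbb R,\mathbb C\}$ let $T^{\mathbb F}=T^{\mathbb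 F}(x)$ be the Terwilliger algebra, i.e. the subalgebra of $\mathrm{Mat}_X(\mathbb F)$ generated by $A$ and the diagonal matrices $E_i^*$ $(0\le i\le D)$ with $(E_i^*)_{y,y}=1$ if $\partial(x,y)=i$ and $(E_i^*)_{y,y}=0$ otherwise. A $T^{\mathbb R}$-module means a subspace $W$ of $\mathbb R^X$ with $T^{\mathbb R}W\subseteq W$. Its complexification $W^{\mathbb C}=W\otimes_{\mathbb R}\mathbb C$ is a module for $T^{\mathbb C}=T^{\mathbb R}+\boldsymbol{i}\,T^{\mathbb R}$, where $(B_1+\boldsymbol{i}B_2)(w\otimes c)=B_1w\otimes c+B_2w\otimes \boldsymbol{i}c$ for $B_1,B_2\in T^{\mathbb R}$, $w\in W$, $c\in\mathbb C$. A module is irreducible if it is nonzero and has no submodules other than $0$ and itself. If $W$ is an irreducible $T^{\mathbb R}$-module, then its complexification $W^{\mathbb C}$ is an irreducible $T^{\mathbb C}$-module. -/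

import Mathlib

open scoped Matrix TensorProduct Matrix.Module

namespace QPolyDRG

variable {X : Type*}

/-- A finite graph is distance-regular when it is connected and the number of vertices at
distance `i` from `y` and distance `j` from `z` depends only on `i`, `j` and the distance between
`y` and `z`. The intersection number `p^h_{i,j}` is `p h i j`. -/
def IsDistanceRegular [Fintype X] (G : SimpleGraph X) : Prop :=
  G.Connected ∧ ∃ p : ℕ → ℕ → ℕ → ℕ, ∀ h i j : ℕ, h ≤ G.diam → i ≤ G.diam → j ≤ G.diam →
    ∀ y z : X, G.dist y z = h →
      (Finset.univ.filter fun w : X => G.dist y w = i ∧ G.dist z w = j).card = p h i j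

/-- `E 0, …, E D` is an ordering of the primitive idempotents of the adjacency matrix `A` of `G`:
there is an ordering `θ 0, …, θ D` of the distinct eigenvalues of `A`, with `θ 0` the valency,
such that `E i` is the identity on the `θ i`-eigenspace of `A` and zero on the other
eigenspaces. -/
def IsPrimitiveIdempotentOrdering [Fintype X] [DecidableEq X] (G : SimpleGraph X)
    [DecidableRel G.Adj] (E : Fin (G.diam + 1) → Matrix X X ℝ) : Prop :=
  ∃ θ : Fin (G.diam + 1) → ℝ,
    Function.Injective θ ∧
    (∀ μ : ℝ, Module.End.HasEigenvalue (Matrix.toLin' (G.adjMatrix ℝ)) μ ↔ ∃ i, θ i = μ) ∧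
    (∀ y : X, (G.degree y : ℝ) = θ 0) ∧
    (∀ i, ∀ v : X → ℝ, G.adjMatrix ℝ *ᵥ v = θ i • v → E i *ᵥ v = v) ∧
    (∀ i j, j ≠ i → ∀ v : X → ℝ, G.adjMatrix ℝ *ᵥ v = θ j • v → E i *ᵥ v = 0)

/-- The ordering `E 0, …, E D` is `Q`-polynomial. The scalars `q h i j` are the Krein parameters
`q^h_{i,j}`, the structure constants of the entrywise product in the basis `E`. -/
def IsQPolynomialOrdering [Fintype X] [DecidableEq X] (G : SimpleGraph X)
    [DecidableRel G.Adj] (E : Fin (G.diam + 1) → Matrix X X ℝ) : Prop :=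
  IsPrimitiveIdempotentOrdering G E ∧
  ∃ q : Fin (G.diam + 1) → Fin (G.diam + 1) → Fin (G.diam + 1) → ℝ,
    (∀ i j, E i ⊙ E j = (Fintype.card X : ℝ)⁻¹ • ∑ h, q h i j • E h) ∧
    (∀ h i j : Fin (G.diam + 1),
      ((h : ℕ) > i + j ∨ (i : ℕ) > h + j ∨ (j : ℕ) > h + i) → q h i j = 0) ∧
    (∀ h i j : Fin (G.diam + 1),
      ((h : ℕ) = i + j ∨ (i : ℕ) = h + j ∨ (j : ℕ) = h + i) → q h i j ≠ 0)

/-- The `i`-th dual primitive idempotent `E_i^*(x)`: the diagonal `0`-`1` matrix that selects the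
vertices at distance `i` from the base vertex `x`. -/
noncomputable def dualIdempotent (𝕜 : Type*) [Zero 𝕜] [One 𝕜] [DecidableEq X] (G : SimpleGraph X) (x : X)
    (i : ℕ) : Matrix X X 𝕜 :=
  Matrix.diagonal fun y => if G.dist x y = i then 1 else 0

/-- The Terwilliger algebra `T(x)` over `𝕜`, generated by the adjacency matrix and the dual
primitive idempotents with respect to `x`. -/
noncomputable def terwilliger (𝕜 : Type*) [Field 𝕜] [Fintype X] [DecidableEq X] (G : SimpleGraph X)
    [DecidableRel G.Adj] (x : X) : Subalgebra 𝕜 (Matrix X X 𝕜) :=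
  Algebra.adjoin 𝕜
    ({G.adjMatrix 𝕜} ∪ {B | ∃ i : ℕ, i ≤ G.diam ∧ B = dualIdempotent 𝕜 G x i})

/-! ### The complexification of a module

A `T`-module is a `T`-submodule of the standard module `X → 𝕜`, on which matrices act by left
multiplication. For a `T^ℝ`-module `W`, the space `ℂ ⊗[ℝ] W` is made a `T^ℂ`-module by
`(B₁ + i B₂) (c ⊗ w) = c ⊗ B₁ w + i c ⊗ B₂ w` for `B₁`, `B₂` in `T^ℝ`. -/

section Complexification

variable [Fintype X] [DecidableEq X] {G : SimpleGraph X} [DecidableRel G.Adj] {x : X}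

theorem smul_eq_mulVec {𝕜 : Type*} [Field 𝕜] (B : Matrix X X 𝕜) (v : X → 𝕜) :
    B • v = B *ᵥ v := rfl

/-- Entrywise real and imaginary parts of a member of `T^ℂ` lie in `T^ℝ`. -/
theorem re_im_mem {B : Matrix X X ℂ} (hB : B ∈ terwilliger ℂ G x) :
    B.map Complex.re ∈ terwilliger ℝ G x ∧ B.map Complex.im ∈ terwilliger ℝ G x := by
  unfold terwilliger at hB
  induction hB using Algebra.adjoin_induction with
  | mem B hB =>
    rcases hB with hB | ⟨i, hi, rfl⟩
    · obtain rfl := hB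
      have h1 : (G.adjMatrix ℂ).map Complex.re = G.adjMatrix ℝ := by
        ext a b; by_cases h : G.Adj a b <;> simp [h]
      have h2 : (G.adjMatrix ℂ).map Complex.im = 0 := by
        ext a b; by_cases h : G.Adj a b <;> simp [h]
      rw [h1, h2]
      exact ⟨Algebra.subset_adjoin (Or.inl rfl), zero_mem _⟩
    · have h1 : (dualIdempotent ℂ G x i).map Complex.re = dualIdempotent ℝ G x i := by
        ext a b
        by_cases h : a = b <;> by_cases h' : G.dist x b = i <;>
          simp [dualIdempotent, h, h']
      have h2 : (dualIdempotent ℂ G x i).map Complex.im = 0 := by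
        ext a b
        by_cases h : a = b <;> by_cases h' : G.dist x b = i <;>
          simp [dualIdempotent, h, h']
      rw [h1, h2]
      exact ⟨Algebra.subset_adjoin (Or.inr ⟨i, hi, rfl⟩), zero_mem _⟩
  | algebraMap r =>
    have h1 : (algebraMap ℂ (Matrix X X ℂ) r).map Complex.re
        = algebraMap ℝ (Matrix X X ℝ) r.re := by
      ext a b; by_cases h : a = b <;> simp [Matrix.algebraMap_matrix_apply, h]
    have h2 : (algebraMap ℂ (Matrix X X ℂ) r).map Complex.im
        = algebraMap ℝ (Matrix X X ℝ) r.im := by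
      ext a b; by_cases h : a = b <;> simp [Matrix.algebraMap_matrix_apply, h]
    rw [h1, h2]
    exact ⟨Subalgebra.algebraMap_mem _ _, Subalgebra.algebraMap_mem _ _⟩
  | add B C _ _ hB hC =>
    have h1 : (B + C).map Complex.re = B.map Complex.re + C.map Complex.re := by
      ext; simp
    have h2 : (B + C).map Complex.im = B.map Complex.im + C.map Complex.im := by
      ext; simp
    rw [h1, h2]
    exact ⟨add_mem hB.1 hC.1, add_mem hB.2 hC.2⟩
  | mul B C _ _ hB hC =>
    have h1 : (B * C).map Complex.re
        = B.map Complex.re * C.map Complex.re - B.map Complex.im * C.map Complex.im := by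
      ext; simp [Matrix.mul_apply, Finset.sum_sub_distrib]
    have h2 : (B * C).map Complex.im
        = B.map Complex.re * C.map Complex.im + B.map Complex.im * C.map Complex.re := by
      ext; simp [Matrix.mul_apply, Finset.sum_add_distrib]
    rw [h1, h2]
    exact ⟨sub_mem (mul_mem hB.1 hC.1) (mul_mem hB.2 hC.2),
      add_mem (mul_mem hB.1 hC.2) (mul_mem hB.2 hC.1)⟩

/-- The real part of a member of `T^ℂ`, as a member of `T^ℝ`. -/
noncomputable def rePart (B : terwilliger ℂ G x) : terwilliger ℝ G x :=
  ⟨(B : Matrix X X ℂ).map Complex.re, (re_im_mem B.2).1⟩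

/-- The imaginary part of a member of `T^ℂ`, as a member of `T^ℝ`. -/
noncomputable def imPart (B : terwilliger ℂ G x) : terwilliger ℝ G x :=
  ⟨(B : Matrix X X ℂ).map Complex.im, (re_im_mem B.2).2⟩

variable {W : Submodule (terwilliger ℝ G x) (X → ℝ)}

/-- A member of `T^ℂ` acts on `ℂ ⊗[ℝ] W` through its real and imaginary parts. -/
noncomputable instance complexificationSMul : SMul (terwilliger ℂ G x) (ℂ ⊗[ℝ] W) where
  smul B z :=
    (Algebra.lsmul ℝ ℝ W (rePart B)).baseChange ℂ z
      + Complex.I • (Algebra.lsmul ℝ ℝ W (imPart B)).baseChange ℂ z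

theorem complexification_smul_tmul (B : terwilliger ℂ G x) (c : ℂ) (w : W) :
    B • (c ⊗ₜ[ℝ] w) = c ⊗ₜ[ℝ] (rePart B • w) + (Complex.I * c) ⊗ₜ[ℝ] (imPart B • w) := rfl

variable (W) in
/-- The canonical map `ℂ ⊗[ℝ] W → (X → ℂ)`, which sends `c ⊗ w` to `c • w`. -/
noncomputable def complexificationMap : (ℂ ⊗[ℝ] W) →ₗ[ℂ] (X → ℂ) :=
  LinearMap.liftBaseChange ℂ
    { toFun := fun w : W => fun y => (((w : X → ℝ) y : ℝ) : ℂ)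
      map_add' := fun v w => by ext; simp
      map_smul' := fun r w => by ext; simp }

theorem complexificationMap_tmul (c : ℂ) (w : W) :
    complexificationMap W (c ⊗ₜ[ℝ] w) = fun y => c * (((w : X → ℝ) y : ℝ) : ℂ) := rfl

theorem exists_eq_tmul_add (z : ℂ ⊗[ℝ] W) :
    ∃ u v : W, z = (1 : ℂ) ⊗ₜ[ℝ] u + Complex.I ⊗ₜ[ℝ] v := by
  induction z with
  | zero => exact ⟨0, 0, by simp⟩
  | tmul c w =>
    refine ⟨c.re • w, c.im • w, ?_⟩
    rw [← TensorProduct.smul_tmul, ← TensorProduct.smul_tmul, ← TensorProduct.add_tmul]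
    congr 1
    apply Complex.ext <;> simp
  | add a b ha hb =>
    obtain ⟨u, v, rfl⟩ := ha
    obtain ⟨u', v', rfl⟩ := hb
    refine ⟨u + u', v + v', ?_⟩
    rw [TensorProduct.tmul_add, TensorProduct.tmul_add]
    abel

theorem complexificationMap_injective : Function.Injective (complexificationMap W) := by
  rw [injective_iff_map_eq_zero]
  intro z hz
  obtain ⟨u, v, rfl⟩ := exists_eq_tmul_add z
  rw [map_add, complexificationMap_tmul, complexificationMap_tmul] at hz
  have hu : u = 0 := by
    ext y
    simpa using congrArg Complex.re (congrFun hz y)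
  have hv : v = 0 := by
    ext y
    simpa using congrArg Complex.im (congrFun hz y)
  simp [hu, hv]

theorem complexificationMap_smul (B : terwilliger ℂ G x) (z : ℂ ⊗[ℝ] W) :
    complexificationMap W (B • z) = B • complexificationMap W z := by
  have hadd (a b : ℂ ⊗[ℝ] W) : B • (a + b) = B • a + B • b := by
    change LinearMap.baseChange ℂ _ _ + Complex.I • LinearMap.baseChange ℂ _ _ =
      (LinearMap.baseChange ℂ _ _ + Complex.I • LinearMap.baseChange ℂ _ _) +
      (LinearMap.baseChange ℂ _ _ + Complex.I • LinearMap.baseChange ℂ _ _)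
    rw [map_add, map_add, smul_add]
    abel
  induction z with
  | zero =>
    have h0 : B • (0 : ℂ ⊗[ℝ] W) = 0 := by
      have := hadd 0 0
      simpa using this
    rw [h0, map_zero, smul_zero]
  | tmul c w =>
    rw [complexification_smul_tmul, map_add, complexificationMap_tmul, complexificationMap_tmul,
      complexificationMap_tmul]
    ext y
    change c * ((∑ j, ((B : Matrix X X ℂ) y j).re * (w : X → ℝ) j : ℝ) : ℂ)
      + Complex.I * c * ((∑ j, ((B : Matrix X X ℂ) y j).im * (w : X → ℝ) j : ℝ) : ℂ)
      = ∑ j, (B : Matrix X X ℂ) y j * (c * (((w : X → ℝ) j : ℝ) : ℂ))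
    push_cast
    rw [Finset.mul_sum, Finset.mul_sum, ← Finset.sum_add_distrib]
    refine Finset.sum_congr rfl fun j _ => ?_
    conv_rhs => rw [← Complex.re_add_im ((B : Matrix X X ℂ) y j)]
    ring
  | add a b ha hb => rw [hadd, map_add, ha, hb, map_add, smul_add]

/-- The complexification `ℂ ⊗[ℝ] W` of a `T^ℝ`-module `W` is a `T^ℂ`-module. -/
noncomputable instance complexificationModule : Module (terwilliger ℂ G x) (ℂ ⊗[ℝ] W) :=
  Function.Injective.module (terwilliger ℂ G x) (complexificationMap W).toAddMonoidHom
    complexificationMap_injective complexificationMap_smul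

end Complexification

end QPolyDRG

/-! It suffices that some element of `T^ℝ` acts on the irreducible module `W` as a projection onto a
real line `ℝ u`. Every nonzero submodule of `ℂ ⊗ W` then contains a nonzero complex multiple of `1 ⊗
u`, and `u` generates `W` (`isSimpleModule_complexification`). The element is `E_r^*`, with `r`
least such that `E_r^* W ≠ 0` (`exists_dualIdempotent_mulVec_eq`).

Let `a` be the adjacency matrix and `b` the diagonal matrix of the row of `x` in `E 1`. Each acts
tridiagonally on the ordered eigenspaces of the other: in one direction by the triangle inequality,
in the other by the vanishing of Krein parameters. Together they generate `T^ℝ`. On `W`, `E_r^*` is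
the projection `f 0` onto the first nonzero eigenspace of `b`. Two facts hold for such pairs: the
elements `f 0 * p(a) * f 0` commute (`corner_commute`), and a subspace of `f 0 • W` stable under
them is stable under `f 0 * t * f 0` for all `t` in `T^ℝ` (`smul_mem_of_mem_adjoin`). The corners of
the `E i` are real symmetric matrices, so commutation yields a real common eigenvector `u`; hence
`E_r^* T u ⊆ ℝ u`, while `T u = W` by irreducibility.

Both facts come from degree counting: if `p` has degree below `s`, then `f 0 * p(a)` meets only the
first `s` eigenspaces of `b`, so a polynomial in `b` to its right may be replaced by one of degree
below `s`. -/

namespace QPolyDRG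

/-! ### Tridiagonal pairs of elements and commutation of the corner. -/

section Tridiagonal

open Polynomial

variable {K R : Type*} [Field K] [Ring R] [Algebra K R]

theorem mul_aeval_mul_congr {b x y z w : R} {s : ℕ} {g : K[X]} (hg : g ∈ degreeLT K s)
    (h : ∀ k < s, x * b ^ k * y = z * b ^ k * w) : x * aeval b g * y = z * aeval b g * w := by
  by_cases hg0 : g = 0
  · simp [hg0]
  have hdeg : g.natDegree < s := (natDegree_lt_iff_degree_lt hg0).2 (mem_degreeLT.1 hg)
  simp only [aeval_eq_sum_range' hdeg, Finset.mul_sum, Finset.sum_mul]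
  refine Finset.sum_congr rfl fun k hk => ?_
  rw [mul_smul_comm, smul_mul_assoc, h k (Finset.mem_range.1 hk), mul_smul_comm, smul_mul_assoc]

theorem mem_degreeLT_natDegree_succ (g : K[X]) : g ∈ degreeLT K (g.natDegree + 1) :=
  mem_degreeLT.2 (degree_le_natDegree.trans_lt (by exact_mod_cast Nat.lt_succ_self _))

/-- `e 0, …, e (n - 1)` are the spectral idempotents of `a` for the distinct eigenvalues
`θ 0, …, θ (n - 1)`, and `b` acts on the eigenspaces of `a` in a tridiagonal way. -/
structure IsTridiagonal (a b : R) (n : ℕ) (θ : ℕ → K) (e : ℕ → R) : Prop where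
  inj : Set.InjOn θ (Finset.range n)
  mul_e : ∀ i, a * e i = θ i • e i
  e_mul : ∀ i, e i * a = θ i • e i
  sum_e : ∑ i ∈ Finset.range n, e i = 1
  tri : ∀ i j, i + 1 < j ∨ j + 1 < i → e i * b * e j = 0

namespace IsTridiagonal

variable {a b : R} {n : ℕ} {θ : ℕ → K} {e : ℕ → R}

theorem aeval_mul_e (h : IsTridiagonal a b n θ e) (p : K[X]) (i : ℕ) :
    aeval a p * e i = p.eval (θ i) • e i := by
  induction p using Polynomial.induction_on' with
  | add p q hp hq => simp [add_mul, hp, hq, add_smul]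
  | monomial k c =>
    have : a ^ k * e i = θ i ^ k • e i := by
      induction k with
      | zero => simp
      | succ k ih => rw [pow_succ', mul_assoc, ih, mul_smul_comm, h.mul_e, smul_smul, pow_succ]
    rw [aeval_monomial, mul_assoc, this, eval_monomial, ← Algebra.smul_def, smul_smul]

theorem aeval_eq (h : IsTridiagonal a b n θ e) (p : K[X]) :
    aeval a p = ∑ i ∈ Finset.range n, p.eval (θ i) • e i := by
  rw [← mul_one (aeval a p), ← h.sum_e, Finset.mul_sum]
  exact Finset.sum_congr rfl fun i _ => h.aeval_mul_e p i

theorem e_mul_aeval (h : IsTridiagonal a b n θ e) (p : K[X]) (i : ℕ) :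
    e i * aeval a p = p.eval (θ i) • e i := by
  induction p using Polynomial.induction_on' with
  | add p q hp hq => simp [mul_add, hp, hq, add_smul]
  | monomial k c =>
    have : e i * a ^ k = θ i ^ k • e i := by
      induction k with
      | zero => simp
      | succ k ih => rw [pow_succ, ← mul_assoc, ih, smul_mul_assoc, h.e_mul, smul_smul, pow_succ]
    rw [aeval_monomial, Algebra.commutes, ← mul_assoc, this, eval_monomial, ← Algebra.commutes,
      ← Algebra.smul_def, smul_smul]

theorem exists_aeval_eq_e (h : IsTridiagonal a b n θ e) {i : ℕ} (hi : i < n) :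
    ∃ p : K[X], aeval a p = e i := by
  refine ⟨Lagrange.basis (Finset.range n) θ i, ?_⟩
  rw [h.aeval_eq, Finset.sum_eq_single_of_mem i (Finset.mem_range.2 hi)]
  · rw [Lagrange.eval_basis_self h.inj (Finset.mem_range.2 hi), one_smul]
  · intro j hj hji
    rw [Lagrange.eval_basis_of_ne hji.symm hj, zero_smul]

/-- The source of all degree reductions: on `s` eigenvalues a polynomial cannot be told from one of
degree below `s`. Only indices below `n` serve as nodes, since `θ` need not be injective beyond. -/
theorem exists_interpolant (h : IsTridiagonal a b n θ e) (g : K[X]) (J : Finset ℕ) (s : ℕ)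
    (hJ : J.card ≤ s) :
    ∃ p ∈ degreeLT K s, ∀ j ∈ J, j < n → p.eval (θ j) = g.eval (θ j) := by
  have hinj : Set.InjOn θ (J.filter (· < n) : Finset ℕ) := by
    intro i hi j hj hij
    exact h.inj (by simpa using (Finset.mem_filter.1 hi).2)
      (by simpa using (Finset.mem_filter.1 hj).2) hij
  refine ⟨Lagrange.interpolate (J.filter (· < n)) θ fun j => g.eval (θ j), ?_, ?_⟩
  · rw [mem_degreeLT]
    refine (Lagrange.degree_interpolate_lt _ hinj).trans_le ?_
    exact_mod_cast (Finset.card_filter_le _ _).trans hJ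
  · intro j hj hjn
    rw [Lagrange.eval_interpolate_at_node _ hinj (Finset.mem_filter.2 ⟨hj, hjn⟩)]

theorem e_mul_e_of_ne (h : IsTridiagonal a b n θ e) {i j : ℕ} (hi : i < n) (hj : j < n)
    (hij : i ≠ j) : e i * e j = 0 := by
  have h1 : θ i • (e i * e j) = θ j • (e i * e j) := by
    rw [← smul_mul_assoc, ← h.e_mul, mul_assoc, h.mul_e, mul_smul_comm]
  have h2 : θ i ≠ θ j := fun he => hij (h.inj (by simpa using hi) (by simpa using hj) he)
  rw [← sub_eq_zero, ← sub_smul] at h1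
  exact (smul_eq_zero.1 h1).resolve_left (sub_ne_zero.2 h2)

theorem e_mul_pow_mul_e (h : IsTridiagonal a b n θ e) (s : ℕ) {i j : ℕ} (hi : i < n) (hj : j < n)
    (hs : i + s < j ∨ j + s < i) : e i * b ^ s * e j = 0 := by
  induction s generalizing j with
  | zero => rw [pow_zero, mul_one, h.e_mul_e_of_ne hi hj (by omega)]
  | succ s ih =>
    rw [pow_succ, ← mul_assoc, ← mul_one (e i * b ^ s), ← h.sum_e, Finset.mul_sum,
      Finset.sum_mul, Finset.sum_mul]
    refine Finset.sum_eq_zero fun k hk => ?_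
    by_cases hik : i + s < k ∨ k + s < i
    · rw [ih (Finset.mem_range.1 hk) hik, zero_mul, zero_mul]
    · rw [mul_assoc, mul_assoc, ← mul_assoc (e k), h.tri k j (by omega), mul_zero]

theorem e_mul_aeval_mul_e (h : IsTridiagonal a b n θ e) {s : ℕ} {p : K[X]}
    (hp : p ∈ degreeLT K s) {i j : ℕ} (hi : i < n) (hj : j < n) (hs : i + s ≤ j ∨ j + s ≤ i) :
    e i * aeval b p * e j = 0 := by
  by_cases hp0 : p = 0
  · simp [hp0]
  have hdeg : p.natDegree < s := (natDegree_lt_iff_degree_lt hp0).2 (mem_degreeLT.1 hp)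
  rw [aeval_eq_sum_range' hdeg, Finset.mul_sum, Finset.sum_mul]
  refine Finset.sum_eq_zero fun k hk => ?_
  have hk := Finset.mem_range.1 hk
  rw [mul_smul_comm, smul_mul_assoc, h.e_mul_pow_mul_e k hi hj (by omega), smul_zero]

/-- On the left of `e 0`, a polynomial of degree less than `s` in `b` reaches only the first `s`
eigenspaces of `a`. -/
theorem e_zero_mul_aeval_mul_aeval (h : IsTridiagonal a b n θ e) (hn : 0 < n) {s : ℕ} {p : K[X]}
    (hp : p ∈ degreeLT K s) {g g' : K[X]}
    (hg : ∀ j < s, j < n → g.eval (θ j) = g'.eval (θ j)) :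
    e 0 * aeval b p * aeval a g = e 0 * aeval b p * aeval a g' := by
  rw [h.aeval_eq, h.aeval_eq, Finset.mul_sum, Finset.mul_sum]
  refine Finset.sum_congr rfl fun j hj => ?_
  have hj := Finset.mem_range.1 hj
  by_cases hjs : j < s
  · rw [hg j hjs hj]
  · rw [mul_smul_comm, mul_smul_comm, h.e_mul_aeval_mul_e hp hn hj (by omega), smul_zero, smul_zero]

theorem aeval_mul_aeval_mul_e_zero (h : IsTridiagonal a b n θ e) (hn : 0 < n) {s : ℕ} {p : K[X]}
    (hp : p ∈ degreeLT K s) {g g' : K[X]}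
    (hg : ∀ j < s, j < n → g.eval (θ j) = g'.eval (θ j)) :
    aeval a g * aeval b p * e 0 = aeval a g' * aeval b p * e 0 := by
  rw [h.aeval_eq, h.aeval_eq, Finset.sum_mul, Finset.sum_mul, Finset.sum_mul, Finset.sum_mul]
  refine Finset.sum_congr rfl fun j hj => ?_
  have hj := Finset.mem_range.1 hj
  by_cases hjs : j < s
  · rw [hg j hjs hj]
  · rw [smul_mul_assoc, smul_mul_assoc, smul_mul_assoc, smul_mul_assoc,
      h.e_mul_aeval_mul_e hp hj hn (by omega), smul_zero, smul_zero]

variable {n' : ℕ} {θ' : ℕ → K} {f : ℕ → R}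

/-- Induction on `s`. If `p` has degree below `s`, then next to `f 0 * p(a)` the power `b ^ s` can
be replaced by a polynomial of degree below `s`, and the induction hypothesis applies. For general
`p`, the defects `m i j` form an antisymmetric array, zero for `|i - j| > s`, whose rows are
annihilated by every polynomial of degree below `s`; such an array is zero. -/
theorem corner_symm_pow (h : IsTridiagonal a b n θ e) (h' : IsTridiagonal b a n' θ' f)
    (hn' : 0 < n') (s : ℕ) (p q : K[X]) :
    f 0 * aeval a p * b ^ s * aeval a q * f 0 = f 0 * aeval a q * b ^ s * aeval a p * f 0 := by
  induction s using Nat.strong_induction_on generalizing p q with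
  | _ s ih =>
    have hlow (g : K[X]) (hg : g ∈ degreeLT K s) (p q : K[X]) :
        f 0 * aeval a p * aeval b g * aeval a q * f 0 =
          f 0 * aeval a q * aeval b g * aeval a p * f 0 := by
      have := mul_aeval_mul_congr (x := f 0 * aeval a p) (y := aeval a q * f 0)
        (z := f 0 * aeval a q) (w := aeval a p * f 0) hg
        fun k hk => by simpa only [mul_assoc] using ih k hk p q
      simpa only [mul_assoc] using this
    have hdeg (p : K[X]) (hp : p ∈ degreeLT K s) (q : K[X]) :
        f 0 * aeval a p * b ^ s * aeval a q * f 0 =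
          f 0 * aeval a q * b ^ s * aeval a p * f 0 := by
      obtain ⟨g, hg, hgX⟩ := h'.exists_interpolant (X ^ s) (Finset.range s) s (by simp)
      have hgX' : ∀ j < s, j < n' → (X ^ s : K[X]).eval (θ' j) = g.eval (θ' j) :=
        fun j hj hjn => (hgX j (Finset.mem_range.2 hj) hjn).symm
      have h1 := h'.e_zero_mul_aeval_mul_aeval hn' hp hgX'
      have h2 := h'.aeval_mul_aeval_mul_e_zero hn' hp hgX'
      rw [aeval_X_pow] at h1 h2
      rw [h1, hlow g hg]
      calc _ = f 0 * aeval a q * (aeval b g * aeval a p * f 0) := by simp only [mul_assoc]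
        _ = _ := by rw [← h2]; simp only [mul_assoc]
    let m : ℕ → ℕ → R := fun i j =>
      f 0 * e i * b ^ s * e j * f 0 - f 0 * e j * b ^ s * e i * f 0
    have hm (i j : ℕ) : m i j = f 0 * e i * b ^ s * e j * f 0 - f 0 * e j * b ^ s * e i * f 0 := rfl
    have hanti (i j : ℕ) : m i j = -m j i := by rw [hm, hm, neg_sub]
    have row_sum (i : ℕ) (hi : i < n) (p : K[X]) (hp : p ∈ degreeLT K s) :
        ∑ j ∈ Finset.range n, p.eval (θ j) • m i j = 0 := by
      obtain ⟨q, hq⟩ := h.exists_aeval_eq_e hi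
      have := hdeg p hp q
      rw [hq, h.aeval_eq p] at this
      simp only [Finset.mul_sum, Finset.sum_mul, mul_smul_comm, smul_mul_assoc] at this
      simp only [hm, smul_sub, Finset.sum_sub_distrib, this, sub_self]
    -- In row `i`, entries up to the diagonal vanish by antisymmetry and the earlier rows, entries
    -- beyond `i + s` by the band condition. Interpolation at the `s` indices in between isolates
    -- each remaining entry.
    have hzero (i : ℕ) : ∀ j, i < n → j < n → m i j = 0 := by
      induction i using Nat.strong_induction_on with
      | _ i ihi =>
        intro j hi hj
        rcases lt_trichotomy j i with hji | rfl | hij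
        · rw [hanti, ihi j hji i hj hi, neg_zero]
        · simp [hm]
        · have hfar (k : ℕ) (hk : k < n) (hik : i + s < k) : m i k = 0 := by
            have h1 := h.e_mul_pow_mul_e s hi hk (Or.inl hik)
            have h2 := h.e_mul_pow_mul_e s hk hi (Or.inr hik)
            rw [hm, mul_assoc (f 0), mul_assoc (f 0), h1, mul_assoc (f 0) (e k),
              mul_assoc (f 0) (e k * b ^ s), h2]
            simp
          by_cases hs : i + s < j
          · exact hfar j hj hs
          obtain ⟨p, hp, hpj⟩ := h.exists_interpolant (Lagrange.basis (Finset.range n) θ j)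
            (Finset.Icc (i + 1) (i + s)) s (by simp)
          have := row_sum i hi p hp
          rw [Finset.sum_eq_single_of_mem j (Finset.mem_range.2 hj)] at this
          · rwa [hpj j (Finset.mem_Icc.2 (by omega)) hj,
              Lagrange.eval_basis_self h.inj (Finset.mem_range.2 hj), one_smul] at this
          · intro k hk hkj
            have hkn := Finset.mem_range.1 hk
            rcases lt_trichotomy k i with hki | rfl | hik
            · rw [hanti, ihi k hki i hkn hi, neg_zero, smul_zero]
            · simp [hm]
            · by_cases hks : i + s < k
              · rw [hfar k hkn hks, smul_zero]
              · rw [hpj k (Finset.mem_Icc.2 (by omega)) hkn,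
                  Lagrange.eval_basis_of_ne hkj.symm hk, zero_smul]
    rw [h.aeval_eq p, h.aeval_eq q]
    simp only [Finset.mul_sum, Finset.sum_mul, mul_smul_comm, smul_mul_assoc, Finset.smul_sum]
    rw [Finset.sum_comm]
    refine Finset.sum_congr rfl fun i hi => Finset.sum_congr rfl fun j hj => ?_
    have := sub_eq_zero.1 (hzero i j (Finset.mem_range.1 hi) (Finset.mem_range.1 hj))
    rw [smul_comm, this]

/-- The elements `f 0 * x * f 0`, with `x` a polynomial in `a`, commute. -/
theorem corner_commute (h : IsTridiagonal a b n θ e) (h' : IsTridiagonal b a n' θ' f)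
    (hn' : 0 < n') (p q : K[X]) :
    f 0 * aeval a p * f 0 * aeval a q * f 0 = f 0 * aeval a q * f 0 * aeval a p * f 0 := by
  -- The middle `f 0` is a polynomial in `b`, hence a combination of powers covered by
  -- `corner_symm_pow`.
  obtain ⟨g, hg⟩ := h'.exists_aeval_eq_e hn'
  have : f 0 * aeval a p * aeval b g * aeval a q * f 0 =
      f 0 * aeval a q * aeval b g * aeval a p * f 0 := by
    have := mul_aeval_mul_congr (x := f 0 * aeval a p) (y := aeval a q * f 0)
      (z := f 0 * aeval a q) (w := aeval a p * f 0) (mem_degreeLT_natDegree_succ g)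
      fun k _ => by simpa only [mul_assoc] using h.corner_symm_pow h' hn' k p q
    simpa only [mul_assoc] using this
  rwa [hg] at this

/-- The two-sided reduction of `D b ^ s D`, with `D` the algebra of polynomials in `a`. -/
theorem aeval_mul_pow_mul_aeval_mem (h : IsTridiagonal a b n θ e) (s : ℕ) (S : Submodule K R)
    (hS₁ : ∀ p ∈ degreeLT K s, ∀ q : K[X], aeval a p * b ^ s * aeval a q ∈ S)
    (hS₂ : ∀ p : K[X], ∀ q ∈ degreeLT K (s + 1), aeval a p * b ^ s * aeval a q ∈ S)
    (p q : K[X]) : aeval a p * b ^ s * aeval a q ∈ S := by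
  -- The array `e i * b ^ s * e j` is peeled off in hooks. Row `k` has at most the `s + 1` new
  -- entries `k ≤ j ≤ k + s`, so right degree at most `s` suffices; column `k`, whose diagonal entry
  -- is then settled, has only `s`, so left degree below `s` suffices.
  have key (k : ℕ) : ∀ i j, i < n → j < n → min i j = k → e i * b ^ s * e j ∈ S := by
    induction k using Nat.strong_induction_on with
    | _ k ih =>
      have row : ∀ j, k < n → j < n → k ≤ j → e k * b ^ s * e j ∈ S := by
        intro j hk hj hkj
        by_cases hs : k + s < j
        · rw [h.e_mul_pow_mul_e s hk hj (Or.inl hs)]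
          exact zero_mem S
        obtain ⟨p, hp⟩ := h.exists_aeval_eq_e hk
        obtain ⟨q, hq, hqj⟩ := h.exists_interpolant (Lagrange.basis (Finset.range n) θ j)
          (Finset.Icc k (k + s)) (s + 1) (by simp; omega)
        have hmem := hS₂ p q hq
        rw [hp, h.aeval_eq q, Finset.mul_sum, ← Finset.add_sum_erase _ _ (Finset.mem_range.2 hj),
          hqj j (Finset.mem_Icc.2 (by omega)) hj,
          Lagrange.eval_basis_self h.inj (Finset.mem_range.2 hj), one_smul] at hmem
        refine (Submodule.add_mem_iff_left _ (Submodule.sum_mem _ fun l hl => ?_)).1 hmem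
        obtain ⟨hlj, hln⟩ := Finset.mem_erase.1 hl
        have hln' := Finset.mem_range.1 hln
        rw [mul_smul_comm]
        by_cases hlk : l < k
        · exact S.smul_mem _ (ih l hlk k l hk hln' (by omega))
        · by_cases hls : k + s < l
          · rw [h.e_mul_pow_mul_e s hk hln' (Or.inl hls), smul_zero]
            exact zero_mem S
          · rw [hqj l (Finset.mem_Icc.2 (by omega)) hln', Lagrange.eval_basis_of_ne hlj.symm hln,
              zero_smul]
            exact zero_mem S
      have col : ∀ i, k < n → i < n → k < i → e i * b ^ s * e k ∈ S := by
        intro i hk hi hki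
        by_cases hs : k + s < i
        · rw [h.e_mul_pow_mul_e s hi hk (Or.inr hs)]
          exact zero_mem S
        obtain ⟨q, hq⟩ := h.exists_aeval_eq_e hk
        obtain ⟨p, hp, hpi⟩ := h.exists_interpolant (Lagrange.basis (Finset.range n) θ i)
          (Finset.Icc (k + 1) (k + s)) s (by simp)
        have hmem := hS₁ p hp q
        rw [hq, h.aeval_eq p, Finset.sum_mul, Finset.sum_mul,
          ← Finset.add_sum_erase _ _ (Finset.mem_range.2 hi),
          hpi i (Finset.mem_Icc.2 (by omega)) hi,
          Lagrange.eval_basis_self h.inj (Finset.mem_range.2 hi), one_smul] at hmem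
        refine (Submodule.add_mem_iff_left _ (Submodule.sum_mem _ fun l hl => ?_)).1 hmem
        obtain ⟨hli, hln⟩ := Finset.mem_erase.1 hl
        have hln' := Finset.mem_range.1 hln
        rw [smul_mul_assoc, smul_mul_assoc]
        rcases lt_trichotomy l k with hlk | rfl | hkl
        · exact S.smul_mem _ (ih l hlk l k hln' hk (by omega))
        · exact S.smul_mem _ (row l hk hk le_rfl)
        · by_cases hls : k + s < l
          · rw [h.e_mul_pow_mul_e s hln' hk (Or.inr hls), smul_zero]
            exact zero_mem S
          · rw [hpi l (Finset.mem_Icc.2 (by omega)) hln', Lagrange.eval_basis_of_ne hli.symm hln,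
              zero_smul]
            exact zero_mem S
      intro i j hi hj hij
      rcases le_or_gt i j with hle | hlt
      · obtain rfl : i = k := by omega
        exact row j hi hj hle
      · obtain rfl : j = k := by omega
        exact col i hj hi hlt
  rw [h.aeval_eq p, h.aeval_eq q]
  simp only [Finset.mul_sum, Finset.sum_mul, mul_smul_comm, smul_mul_assoc]
  exact S.sum_mem fun i hi => S.smul_mem _ <| S.sum_mem fun j hj => S.smul_mem _
    (key _ _ _ (by simpa using hj) (by simpa using hi) rfl)

end IsTridiagonal
end Tridiagonal

/-! ### Stability of a subspace under the whole corner algebra. -/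

section Corner

open Polynomial

variable {K R V : Type*} [Field K] [Ring R] [Algebra K R]
  [AddCommGroup V] [Module K V] [Module R V] [IsScalarTower K R V]

variable (K) in
/-- The space of polynomials in `x`. -/
noncomputable def polys (x : R) : Submodule K R := LinearMap.range (aeval (R := K) x).toLinearMap

variable (K) in
/-- The space of polynomials of degree less than `s` in `x`. -/
noncomputable def polysLT (x : R) (s : ℕ) : Submodule K R :=
  (degreeLT K s).map (aeval (R := K) x).toLinearMap

theorem aeval_mem_polys (x : R) (p : K[X]) : aeval x p ∈ polys K x := ⟨p, rfl⟩

theorem aeval_mem_polysLT (x : R) {s : ℕ} {p : K[X]} (hp : p ∈ degreeLT K s) :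
    aeval x p ∈ polysLT K x s := ⟨p, hp, rfl⟩

theorem polysLT_le_polys (x : R) (s : ℕ) : polysLT K x s ≤ polys K x := by
  rintro _ ⟨p, -, rfl⟩
  exact aeval_mem_polys x p

theorem polysLT_mono (x : R) {s t : ℕ} (h : s ≤ t) : polysLT K x s ≤ polysLT K x t :=
  Submodule.map_mono (degreeLT_mono h)

theorem polysLT_zero (x : R) : polysLT K x 0 = ⊥ := by
  rw [eq_bot_iff]
  rintro _ ⟨p, hp, rfl⟩
  have : p = 0 := by simpa [mem_degreeLT] using hp
  simp [this]

theorem pow_mem_polysLT (x : R) (s : ℕ) : x ^ s ∈ polysLT K x (s + 1) := by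
  rw [← aeval_X_pow (R := K) x]
  exact aeval_mem_polysLT x
    (mem_degreeLT.2 ((degree_X_pow_le s).trans_lt (by exact_mod_cast s.lt_succ_self)))

theorem polysLT_succ_le (x : R) (s : ℕ) :
    polysLT K x (s + 1) ≤ polysLT K x s ⊔ K ∙ x ^ s := by
  rintro _ ⟨p, hp, rfl⟩
  have hdeg : p.natDegree < s + 1 := by
    by_cases hp0 : p = 0
    · simp [hp0]
    · exact (natDegree_lt_iff_degree_lt hp0).2 (mem_degreeLT.1 hp)
  rw [AlgHom.toLinearMap_apply, aeval_eq_sum_range' hdeg, Finset.sum_range_succ]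
  refine Submodule.add_mem_sup (Submodule.sum_mem _ fun k hk => Submodule.smul_mem _ _ ?_)
    (Submodule.smul_mem _ _ (Submodule.mem_span_singleton_self _))
  exact polysLT_mono x (Finset.mem_range.1 hk) (pow_mem_polysLT x k)

theorem span_pow_le_polysLT (x : R) (s : ℕ) : (K ∙ x ^ s) ≤ polysLT K x (s + 1) := by
  rw [Submodule.span_singleton_le_iff_mem]
  exact pow_mem_polysLT x s

theorem le_polysLT_smul (x : R) (s : ℕ) (N : Submodule K V) : N ≤ polysLT K x (s + 1) • N := by
  intro v hv
  rw [← one_smul R v]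
  refine Submodule.smul_mem_smul (polysLT_mono x (Nat.succ_le_succ s.zero_le) ?_) hv
  simpa using pow_mem_polysLT (K := K) x 0

theorem le_polys_smul (x : R) (N : Submodule K V) : N ≤ polys K x • N :=
  (le_polysLT_smul x 0 N).trans (Submodule.smul_mono_left (polysLT_le_polys x 1))

/-- The reduction of `aeval_mul_pow_mul_aeval_mem` in the form used below: at the price of a sum,
one of the two outer polynomials gets bounded degree. -/
theorem IsTridiagonal.polys_smul_pow_smul_polys_smul_le {a b : R} {n : ℕ} {θ : ℕ → K} {e : ℕ → R}
    (h : IsTridiagonal a b n θ e) (s : ℕ) (N : Submodule K V) :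
    polys K a • (K ∙ b ^ s) • polys K a • N ≤
      polysLT K a s • (K ∙ b ^ s) • polys K a • N ⊔
        polys K a • (K ∙ b ^ s) • polysLT K a (s + 1) • N := by
  have hle : polys K a * (K ∙ b ^ s) * polys K a ≤
      polysLT K a s * (K ∙ b ^ s) * polys K a ⊔ polys K a * (K ∙ b ^ s) * polysLT K a (s + 1) := by
    rw [Submodule.mul_le]
    intro x hx y hy
    obtain ⟨q, rfl⟩ := hy
    refine Submodule.mul_induction_on hx (fun x hx y hy => ?_) fun x y hx hy => ?_
    · obtain ⟨p, rfl⟩ := hx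
      obtain ⟨c, rfl⟩ := Submodule.mem_span_singleton.1 hy
      rw [mul_smul_comm, smul_mul_assoc]
      have hb := Submodule.mem_span_singleton_self (R := K) (b ^ s)
      refine Submodule.smul_mem _ _ (h.aeval_mul_pow_mul_aeval_mem s _ ?_ ?_ p q)
      · intro p hp q
        exact Submodule.mem_sup_left (Submodule.mul_mem_mul
          (Submodule.mul_mem_mul (aeval_mem_polysLT a hp) hb) (aeval_mem_polys a q))
      · intro p q hq
        exact Submodule.mem_sup_right (Submodule.mul_mem_mul
          (Submodule.mul_mem_mul (aeval_mem_polys a p) hb) (aeval_mem_polysLT a hq))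
    · rw [add_mul]; exact add_mem hx hy
  have := Submodule.smul_mono_left (N := N) hle
  simpa only [← smul_eq_mul, Submodule.sup_smul, Submodule.smul_assoc] using this

/-- The alternating sequence `b, a, b, a, …`. -/
def alternate {R : Type*} (a b : R) (k : ℕ) : R := if Even k then b else a

theorem alternate_add_two {R : Type*} (a b : R) (k : ℕ) : alternate a b (k + 2) = alternate a b k := by
  simp [alternate, Nat.even_add]

/-- The spaces obtained from `M` by applying alternately the polynomials in `a` and in `b`. -/
noncomputable def alternatingSpan (a b : R) (M : Submodule K V) : ℕ → Submodule K V
  | 0 => M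
  | k + 1 => polys K (alternate a b (k + 1)) • alternatingSpan a b M k

theorem alternatingSpan_succ (a b : R) (M : Submodule K V) (k : ℕ) :
    alternatingSpan a b M (k + 1) = polys K (alternate a b (k + 1)) • alternatingSpan a b M k := rfl

theorem alternatingSpan_mono (a b : R) (M : Submodule K V) : Monotone (alternatingSpan a b M) :=
  monotone_nat_of_le_succ fun _ => le_polys_smul _ _

theorem polys_smul_alternatingSpan (a b : R) (M : Submodule K V) (k : ℕ) :
    polys K (alternate a b k) • alternatingSpan a b M (k + 1) = alternatingSpan a b M (k + 2) := by
  rw [alternatingSpan_succ a b M (k + 1), alternate_add_two]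

variable {a b : R} {n n' : ℕ} {θ θ' : ℕ → K} {e f : ℕ → R} {M : Submodule K V}

/-- For `m ∈ M`, the vector `a ^ r • m` lies in the eigenspaces `0, …, r` of `b`. Interpolation at
`1, …, r` needs degree below `r`; the error at index `0` is a multiple of `f 0 • a ^ r • m`, which
lies in `M` by `hC`. -/
theorem IsTridiagonal.polys_smul_polysLT_smul_corner_le (h' : IsTridiagonal b a n' θ' f)
    (hn' : 0 < n') (hM : ∀ m ∈ M, f 0 • m = m) (hC : ∀ p : K[X], ∀ m ∈ M, f 0 • aeval a p • m ∈ M)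
    (r : ℕ) :
    polys K b • (K ∙ a ^ r) • M ≤ polysLT K b r • (K ∙ a ^ r) • M ⊔ M := by
  refine Submodule.smul_le.2 fun s hs v hv => ?_
  obtain ⟨g, rfl⟩ := hs
  refine Submodule.smul_induction_on hv (fun t ht m hm => ?_) fun v w hv hw => ?_
  · obtain ⟨c, rfl⟩ := Submodule.mem_span_singleton.1 ht
    obtain ⟨k, hk, hkg⟩ := h'.exists_interpolant g (Finset.Icc 1 r) r (by simp)
    have hev : ∀ j < r + 1, j < n' → g.eval (θ' j) =
        (k + C (g.eval (θ' 0) - k.eval (θ' 0)) * Lagrange.basis (Finset.range n') θ' 0).eval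
          (θ' j) := by
      intro j hj hjn
      rw [eval_add, eval_mul, eval_C]
      rcases Nat.eq_zero_or_pos j with rfl | hj0
      · rw [Lagrange.eval_basis_self h'.inj (by simpa using hn')]
        ring
      · rw [hkg j (Finset.mem_Icc.2 (by omega)) hjn,
          Lagrange.eval_basis_of_ne hj0.ne (by simpa using hjn)]
        ring
    have hX : (X ^ r : K[X]) ∈ degreeLT K (r + 1) :=
      mem_degreeLT.2 ((degree_X_pow_le r).trans_lt (by exact_mod_cast r.lt_succ_self))
    have hbasis : aeval b (Lagrange.basis (Finset.range n') θ' 0) = f 0 := by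
      rw [h'.aeval_eq, Finset.sum_eq_single_of_mem 0 (Finset.mem_range.2 hn'),
        Lagrange.eval_basis_self h'.inj (by simpa using hn'), one_smul]
      intro j hj hj0
      rw [Lagrange.eval_basis_of_ne hj0.symm hj, zero_smul]
    have hkey := h'.aeval_mul_aeval_mul_e_zero hn' hX hev
    rw [aeval_X_pow, map_add, map_mul, aeval_C, hbasis] at hkey
    have hm' : aeval b g • a ^ r • m = aeval b k • a ^ r • m +
        (g.eval (θ' 0) - k.eval (θ' 0)) • f 0 • a ^ r • m := by
      conv_lhs => rw [← hM m hm]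
      rw [smul_smul, smul_smul, hkey, ← smul_smul, hM m hm, add_mul, add_smul, mul_assoc,
        ← Algebra.smul_def, smul_assoc, mul_smul, mul_smul]
    rw [AlgHom.toLinearMap_apply, smul_assoc, smul_algebra_smul_comm, hm', smul_add]
    refine Submodule.add_mem_sup (Submodule.smul_mem _ _ ?_) (Submodule.smul_mem _ _
      (Submodule.smul_mem _ _ ?_))
    · exact Submodule.smul_mem_smul (aeval_mem_polysLT b hk)
        (Submodule.smul_mem_smul (Submodule.mem_span_singleton_self _) hm)
    · simpa using hC (X ^ r) m hm
  · rw [smul_add]; exact add_mem hv hw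

/-- Double induction on `k` and `r`. From `k` to `k + 1` the top power stands between polynomials in
the other generator, and the two-sided reduction bounds one of them: a bound on the left is the
claim, a bound on the right lets the case `k` lower the top power. The truncated `r - 1` is
harmless, since both products vanish at `r = 0`. -/
theorem IsTridiagonal.polys_smul_polysLT_smul_alternatingSpan_le (h : IsTridiagonal a b n θ e)
    (h' : IsTridiagonal b a n' θ' f)
    (hn' : 0 < n') (hM : ∀ m ∈ M, f 0 • m = m) (hC : ∀ p : K[X], ∀ m ∈ M, f 0 • aeval a p • m ∈ M)
    (k r : ℕ) :
    polys K (alternate a b (k + 2)) • polysLT K (alternate a b (k + 1)) r •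
        alternatingSpan a b M k ≤
      polysLT K (alternate a b (k + 2)) (r - 1) • polysLT K (alternate a b (k + 1)) r •
        alternatingSpan a b M k ⊔ alternatingSpan a b M k := by
  induction k generalizing r with
  | zero =>
    induction r with
    | zero => simp [polysLT_zero]
    | succ r ih =>
      refine (Submodule.smul_mono le_rfl (Submodule.smul_mono_left (polysLT_succ_le _ r))).trans ?_
      rw [Submodule.sup_smul, Submodule.smul_sup]
      refine sup_le (ih.trans (sup_le_sup_right (Submodule.smul_mono (polysLT_mono _ (by omega))
        (Submodule.smul_mono_left (polysLT_mono _ (by omega)))) _)) ?_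
      refine (h'.polys_smul_polysLT_smul_corner_le hn' hM hC r).trans (sup_le_sup_right ?_ _)
      exact Submodule.smul_mono le_rfl (Submodule.smul_mono_left (span_pow_le_polysLT a r))
  | succ k ihk =>
    induction r with
    | zero => simp [polysLT_zero]
    | succ r ih =>
      have hmono : polysLT K (alternate a b (k + 3)) (r - 1) • polysLT K (alternate a b (k + 2)) r •
          alternatingSpan a b M (k + 1) ≤ polysLT K (alternate a b (k + 3)) r •
          polysLT K (alternate a b (k + 2)) (r + 1) • alternatingSpan a b M (k + 1) :=
        Submodule.smul_mono (polysLT_mono _ (by omega))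
          (Submodule.smul_mono_left (polysLT_mono _ (by omega)))
      have ih' := ih.trans (sup_le_sup_right hmono _)
      refine (Submodule.smul_mono le_rfl (Submodule.smul_mono_left (polysLT_succ_le _ r))).trans ?_
      rw [Submodule.sup_smul, Submodule.smul_sup]
      refine sup_le ih' ?_
      have hzig : polys K (alternate a b (k + 3)) • (K ∙ alternate a b (k + 2) ^ r) •
            polys K (alternate a b (k + 3)) • alternatingSpan a b M k ≤
          polysLT K (alternate a b (k + 3)) r • (K ∙ alternate a b (k + 2) ^ r) •
            polys K (alternate a b (k + 3)) • alternatingSpan a b M k ⊔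
          polys K (alternate a b (k + 3)) • (K ∙ alternate a b (k + 2) ^ r) •
            polysLT K (alternate a b (k + 3)) (r + 1) • alternatingSpan a b M k := by
        by_cases hk : Even k
        · have h2 : alternate a b (k + 2) = b := by simp [alternate, Nat.even_add, hk]
          have h3 : alternate a b (k + 3) = a := by
            rw [alternate_add_two]; simp [alternate, Nat.even_add, hk]
          rw [h2, h3]
          exact h.polys_smul_pow_smul_polys_smul_le r _
        · have h2 : alternate a b (k + 2) = a := by simp [alternate, Nat.even_add, hk]
          have h3 : alternate a b (k + 3) = b := by
            rw [alternate_add_two]; simp [alternate, Nat.even_add, hk]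
          rw [h2, h3]
          exact h'.polys_smul_pow_smul_polys_smul_le r _
      have hk1 : polys K (alternate a b (k + 3)) • alternatingSpan a b M k =
          alternatingSpan a b M (k + 1) := by
        rw [alternatingSpan_succ, alternate_add_two]
      rw [hk1] at hzig
      refine hzig.trans (sup_le (le_sup_of_le_left (Submodule.smul_mono le_rfl
        (Submodule.smul_mono_left (span_pow_le_polysLT _ r)))) ?_)
      -- The case `k` with bound `r + 1` trades the `r`-th power for degree below `r`, up to a term
      -- one layer down; the inner induction `ih'` then applies.
      have hlow : (K ∙ alternate a b (k + 2) ^ r) •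
            polysLT K (alternate a b (k + 3)) (r + 1) • alternatingSpan a b M k ≤
          polysLT K (alternate a b (k + 2)) r • alternatingSpan a b M (k + 1) ⊔
            alternatingSpan a b M k := by
        rw [alternate_add_two a b (k + 1)]
        refine (Submodule.smul_mono_left ((span_pow_le_polysLT _ r).trans
          (polysLT_le_polys _ _))).trans ((ihk (r + 1)).trans (sup_le_sup_right ?_ _))
        exact Submodule.smul_mono le_rfl (Submodule.smul_mono_left (polysLT_le_polys _ _))
      refine (Submodule.smul_mono le_rfl hlow).trans ?_
      rw [Submodule.smul_sup, hk1]
      exact sup_le ih' le_sup_right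

/-- An outermost polynomial in `b` is absorbed by `f 0` as a scalar. When it is in `a`, two
reductions alternate: if the degree in `b` is at most `s`, the degree in `a` can be brought below
`s` modulo lower layers; then `f 0` times that polynomial in `a` meets only `s` eigenspaces of `b`,
so the degree in `b` drops below `s` too. Descent on `s` ends at zero. -/
theorem IsTridiagonal.smul_alternatingSpan_le (h : IsTridiagonal a b n θ e)
    (h' : IsTridiagonal b a n' θ' f)
    (hn' : 0 < n') (hM : ∀ m ∈ M, f 0 • m = m) (hC : ∀ p : K[X], ∀ m ∈ M, f 0 • aeval a p • m ∈ M)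
    (k : ℕ) : (K ∙ f 0) • alternatingSpan a b M k ≤ M := by
  have hspan (N : Submodule K V) (hN : ∀ v ∈ N, f 0 • v ∈ M) : (K ∙ f 0) • N ≤ M := by
    refine Submodule.smul_le.2 fun x hx v hv => ?_
    obtain ⟨c, rfl⟩ := Submodule.mem_span_singleton.1 hx
    rw [smul_assoc]
    exact M.smul_mem c (hN v hv)
  induction k with
  | zero => exact hspan _ fun v hv => by rw [hM v hv]; exact hv
  | succ k ih =>
    have hmem (v : V) (hv : v ∈ alternatingSpan a b M k) : f 0 • v ∈ M :=
      ih (Submodule.smul_mem_smul (Submodule.mem_span_singleton_self _) hv)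
    rcases k with _ | k
    · refine hspan _ fun v hv => ?_
      refine Submodule.smul_induction_on hv (fun t ht m hm => ?_) fun v w hv hw => ?_
      · obtain ⟨p, rfl⟩ := ht
        simpa [alternate] using hC p m hm
      · rw [smul_add]; exact add_mem hv hw
    by_cases hk : Even k
    · refine hspan _ fun v hv => ?_
      have h2 : alternate a b (k + 2) = b := by simp [alternate, Nat.even_add, hk]
      rw [alternatingSpan_succ, h2] at hv
      refine Submodule.smul_induction_on hv (fun t ht m hm => ?_) fun v w hv hw => ?_
      · obtain ⟨p, rfl⟩ := ht
        rw [smul_smul, AlgHom.toLinearMap_apply, h'.e_mul_aeval, smul_assoc]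
        exact M.smul_mem _ (hmem m hm)
      · rw [smul_add]; exact add_mem hv hw
    · have h1 : alternate a b (k + 1) = b := by simp [alternate, Nat.even_add, hk]
      have h2 : alternate a b (k + 2) = a := by simp [alternate, Nat.even_add, hk]
      have key (s : ℕ) : (K ∙ f 0) • polys K a • polysLT K b s • alternatingSpan a b M k ≤ M := by
        induction s with
        | zero => simp [polysLT_zero]
        | succ s ihs =>
          have hQ := h.polys_smul_polysLT_smul_alternatingSpan_le h' hn' hM hC k (s + 1)
          rw [h1, h2, Nat.add_sub_cancel] at hQ
          refine (Submodule.smul_mono le_rfl hQ).trans ?_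
          rw [Submodule.smul_sup]
          refine sup_le ?_ ((Submodule.smul_mono le_rfl
            (alternatingSpan_mono a b M k.le_succ)).trans ih)
          rw [← Submodule.smul_assoc, ← Submodule.smul_assoc] at ihs ⊢
          refine (Submodule.smul_mono_left ?_).trans ihs
          rw [smul_eq_mul, smul_eq_mul, Submodule.mul_le]
          intro x hx y hy
          obtain ⟨g, hg, rfl⟩ := hy
          refine Submodule.mul_induction_on hx (fun x hx y hy => ?_) fun x y hx hy => ?_
          · obtain ⟨c, rfl⟩ := Submodule.mem_span_singleton.1 hx
            obtain ⟨p, hp, rfl⟩ := hy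
            obtain ⟨g', hg', hgg'⟩ := h'.exists_interpolant g (Finset.range s) s (by simp)
            have := h'.e_zero_mul_aeval_mul_aeval hn' hp
              fun j hj hjn => (hgg' j (Finset.mem_range.2 hj) hjn).symm
            rw [smul_mul_assoc, smul_mul_assoc]
            refine Submodule.smul_mem _ _ ?_
            rw [AlgHom.toLinearMap_apply, AlgHom.toLinearMap_apply, this]
            exact Submodule.smul_mem_smul (Submodule.smul_mem_smul
              (Submodule.mem_span_singleton_self _) (aeval_mem_polys a p))
              (aeval_mem_polysLT b hg')
          · rw [add_mul]; exact add_mem hx hy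
      refine hspan _ fun v hv => ?_
      rw [alternatingSpan_succ, alternatingSpan_succ, h1, h2] at hv
      refine Submodule.smul_induction_on hv (fun t ht v hv => ?_) fun v w hv hw => ?_
      · refine Submodule.smul_induction_on hv (fun t' ht' m hm => ?_) fun v w hv hw => ?_
        · obtain ⟨g, rfl⟩ := ht'
          exact key (g.natDegree + 1) (Submodule.smul_mem_smul
            (Submodule.mem_span_singleton_self _) (Submodule.smul_mem_smul ht
            (Submodule.smul_mem_smul (aeval_mem_polysLT b (mem_degreeLT_natDegree_succ g)) hm)))
        · rw [smul_add, smul_add]; exact add_mem hv hw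
      · rw [smul_add]; exact add_mem hv hw

/-- A subspace `M` of `f 0 • V` that is stable under `f 0 * x * f 0` for the polynomials `x` in `a`
is stable under `f 0 * x * f 0` for all `x` in the algebra generated by `a` and `b`. -/
theorem IsTridiagonal.smul_mem_of_mem_adjoin (h : IsTridiagonal a b n θ e)
    (h' : IsTridiagonal b a n' θ' f)
    (hn' : 0 < n') (hM : ∀ m ∈ M, f 0 • m = m) (hC : ∀ p : K[X], ∀ m ∈ M, f 0 • aeval a p • m ∈ M)
    {t : R} (ht : t ∈ Algebra.adjoin K {a, b}) {m : V} (hm : m ∈ M) : f 0 • t • m ∈ M := by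
  -- The increasing union of the alternating spans is stable under `a` and `b`, hence under `t`, so
  -- `t • m` lies in some finite layer, which `f 0` maps into `M`.
  have hiSup (v : V) : v ∈ ⨆ k, alternatingSpan a b M k ↔ ∃ k, v ∈ alternatingSpan a b M k :=
    Submodule.mem_iSup_of_directed _ (alternatingSpan_mono a b M).directed_le
  have hgen (k l : ℕ) (v : V) (hv : v ∈ alternatingSpan a b M k) :
      alternate a b l • v ∈ ⨆ k, alternatingSpan a b M k := by
    have hx : alternate a b l ∈ polys K (alternate a b l) := by
      simpa using aeval_mem_polys (K := K) (alternate a b l) X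
    rw [hiSup]
    -- Two further layers involve both generators, whatever the parities of `k` and `l`.
    refine ⟨k + 2, ?_⟩
    by_cases hkl : Even k ↔ Even l
    · have : alternate a b l = alternate a b k := by simp [alternate, hkl]
      rw [← polys_smul_alternatingSpan, ← this]
      exact Submodule.smul_mem_smul hx (alternatingSpan_mono a b M k.le_succ hv)
    · have : alternate a b l = alternate a b (k + 1) := by
        by_cases hk : Even k <;> by_cases hl : Even l <;>
          simp_all [alternate, Nat.even_add]
      refine alternatingSpan_mono a b M (Nat.le_succ (k + 1)) ?_
      rw [alternatingSpan_succ, ← this]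
      exact Submodule.smul_mem_smul hx hv
  have hstable : ∀ v ∈ ⨆ k, alternatingSpan a b M k, t • v ∈ ⨆ k, alternatingSpan a b M k := by
    induction ht using Algebra.adjoin_induction with
    | mem x hx =>
      intro v hv
      obtain ⟨k, hk⟩ := (hiSup v).1 hv
      rcases hx with rfl | hx
      · simpa [alternate] using hgen k 1 v hk
      · rw [Set.mem_singleton_iff.1 hx]
        simpa [alternate] using hgen k 0 v hk
    | algebraMap r =>
      intro v hv
      rw [algebraMap_smul]
      exact Submodule.smul_mem _ r hv
    | add x y _ _ hx hy =>
      intro v hv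
      rw [add_smul]
      exact add_mem (hx v hv) (hy v hv)
    | mul x y _ _ hx hy =>
      intro v hv
      rw [mul_smul]
      exact hx _ (hy v hv)
  obtain ⟨k, hk⟩ := (hiSup _).1 (hstable m ((hiSup m).2 ⟨0, hm⟩))
  exact h.smul_alternatingSpan_le h' hn' hM hC k
    (Submodule.smul_mem_smul (Submodule.mem_span_singleton_self _) hk)

end Corner

/-! ### Spectral and `Q`-polynomial properties of the graph. -/

section DistanceRegular

variable {X : Type*} [Fintype X] [DecidableEq X]

/-- Two matrices that agree on the eigenvectors of a symmetric matrix are equal. -/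
theorem eq_of_mulVec_eq_on_eigenvectors {A M N : Matrix X X ℝ} (hA : A.IsHermitian)
    (h : ∀ μ : ℝ, ∀ v : X → ℝ, v ≠ 0 → A *ᵥ v = μ • v → M *ᵥ v = N *ᵥ v) : M = N := by
  have hMU : M * (hA.eigenvectorUnitary : Matrix X X ℝ) = N * hA.eigenvectorUnitary := by
    ext i j
    have hv := h _ (⇑(hA.eigenvectorBasis j)) ?_ (hA.mulVec_eigenvectorBasis j)
    · exact congrFun hv i
    · intro h0
      exact hA.eigenvectorBasis.toBasis.ne_zero j (by
        ext k
        simpa using congrFun h0 k)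
  have hU : (hA.eigenvectorUnitary : Matrix X X ℝ) * star (hA.eigenvectorUnitary : Matrix X X ℝ)
      = 1 := Unitary.coe_mul_star_self _
  rw [← mul_one M, ← hU, ← mul_assoc, hMU, mul_assoc, hU, mul_one]

variable {G : SimpleGraph X} [DecidableRel G.Adj]

/-- The spectral resolution `E` of the adjacency matrix, in algebraic form. -/
structure IsSpectralResolution (G : SimpleGraph X) [DecidableRel G.Adj]
    (E : Fin (G.diam + 1) → Matrix X X ℝ) (θ : Fin (G.diam + 1) → ℝ) : Prop where
  inj : Function.Injective θ
  degree_eq : ∀ y : X, (G.degree y : ℝ) = θ 0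
  adj_mul : ∀ i, G.adjMatrix ℝ * E i = θ i • E i
  mul_adj : ∀ i, E i * G.adjMatrix ℝ = θ i • E i
  sum_eq : ∑ i, E i = 1
  mul_of_ne : ∀ i j, i ≠ j → E i * E j = 0
  transpose_eq : ∀ i, (E i)ᵀ = E i

theorem isHermitian_adjMatrix {X : Type*} (G : SimpleGraph X) [DecidableRel G.Adj] :
    (G.adjMatrix ℝ).IsHermitian := by
  rw [Matrix.IsHermitian, Matrix.conjTranspose_eq_transpose_of_trivial, G.transpose_adjMatrix]

theorem IsPrimitiveIdempotentOrdering.exists_isSpectralResolution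
    {E : Fin (G.diam + 1) → Matrix X X ℝ} (hE : IsPrimitiveIdempotentOrdering G E) :
    ∃ θ, IsSpectralResolution G E θ := by
  obtain ⟨θ, hinj, heig, hdeg, hid, hzero⟩ := hE
  have hext {M N : Matrix X X ℝ}
      (h : ∀ i, ∀ v : X → ℝ, G.adjMatrix ℝ *ᵥ v = θ i • v → M *ᵥ v = N *ᵥ v) : M = N := by
    refine eq_of_mulVec_eq_on_eigenvectors (isHermitian_adjMatrix G) fun μ v hv0 hv => ?_
    obtain ⟨i, rfl⟩ := (heig μ).1 (Module.End.hasEigenvalue_of_hasEigenvector (x := v)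
      ⟨Module.End.mem_eigenspace_iff.2 (by rw [Matrix.toLin'_apply, hv]), hv0⟩)
    exact h i v hv
  have hE (i j : Fin (G.diam + 1)) (v : X → ℝ) (hv : G.adjMatrix ℝ *ᵥ v = θ j • v) :
      E i *ᵥ v = if j = i then v else 0 := by
    split_ifs with h
    · subst h
      exact hid _ v hv
    · exact hzero i j h v hv
  have hleft (i) : G.adjMatrix ℝ * E i = θ i • E i := hext fun j v hv => by
    rw [← Matrix.mulVec_mulVec, Matrix.smul_mulVec, hE i j v hv]
    split_ifs with h
    · rw [hv, h]
    · simp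
  have hmul (i j) (hij : i ≠ j) : E i * E j = 0 := hext fun k v hv => by
    rw [← Matrix.mulVec_mulVec, hE j k v hv]
    split_ifs with h
    · rw [hE i k v hv, if_neg (by rintro rfl; exact hij h), Matrix.zero_mulVec]
    · simp
  have hsum : ∑ i, E i = 1 := hext fun k v hv => by
    rw [Matrix.sum_mulVec, Matrix.one_mulVec, Finset.sum_congr rfl fun i _ => hE i k v hv]
    simp
  -- Comparing eigenvalues of the symmetric adjacency matrix gives `(E i)ᵀ * E j = 0` for `j ≠ i`.
  -- Hence `(E i)ᵀ = (E i)ᵀ * E i`, and the right side is symmetric.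
  have htr (i) : (E i)ᵀ = E i := by
    have hne (j) (hij : j ≠ i) : (E i)ᵀ * E j = 0 := by
      have h1 : θ i • ((E i)ᵀ * E j) = θ j • ((E i)ᵀ * E j) := by
        rw [← Matrix.smul_mul, ← Matrix.transpose_smul, ← hleft, Matrix.transpose_mul,
          G.transpose_adjMatrix, mul_assoc, hleft, Matrix.mul_smul]
      rw [← sub_eq_zero, ← sub_smul] at h1
      exact (smul_eq_zero.1 h1).resolve_left (sub_ne_zero.2 fun h => hij (hinj h).symm)
    have h2 : (E i)ᵀ = (E i)ᵀ * E i := by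
      conv_lhs => rw [← mul_one (E i)ᵀ, ← hsum, Finset.mul_sum]
      exact Finset.sum_eq_single_of_mem i (Finset.mem_univ i) fun j _ hj => hne j hj
    have h3 := congrArg Matrix.transpose h2
    rw [Matrix.transpose_mul, Matrix.transpose_transpose, ← h2] at h3
    exact h3.symm
  refine ⟨θ, hinj, hdeg, hleft, fun i => ?_, hsum, hmul, htr⟩
  have h := congrArg Matrix.transpose (hleft i)
  rwa [Matrix.transpose_mul, Matrix.transpose_smul, htr, G.transpose_adjMatrix] at h

theorem IsDistanceRegular.dist_le {X : Type*} [Fintype X] {G : SimpleGraph X}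
    (hG : IsDistanceRegular G) (y z : X) :
    G.dist y z ≤ G.diam := by
  have : Nonempty X := ⟨y⟩
  exact SimpleGraph.dist_le_diam (SimpleGraph.connected_iff_ediam_ne_top.1 hG.1)

/-- The entries of a power of the adjacency matrix depend only on the distance. -/
theorem IsDistanceRegular.exists_adjMatrix_pow_apply (hG : IsDistanceRegular G)
    (hD : 1 ≤ G.diam) (k : ℕ) :
    ∃ c : ℕ → ℝ, ∀ y z, (G.adjMatrix ℝ ^ k) y z = c (G.dist y z) := by
  induction k with
  | zero =>
    refine ⟨fun i => if i = 0 then 1 else 0, fun y z => ?_⟩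
    simp [Matrix.one_apply, hG.1.dist_eq_zero_iff]
  | succ k ih =>
    obtain ⟨c, hc⟩ := ih
    obtain ⟨p, hp⟩ := hG.2
    refine ⟨fun h => ∑ j ∈ Finset.range (G.diam + 1), c j * p h 1 j, fun y z => ?_⟩
    rw [pow_succ', Matrix.mul_apply]
    calc ∑ w, G.adjMatrix ℝ y w * (G.adjMatrix ℝ ^ k) w z
        = ∑ w, ∑ j ∈ Finset.range (G.diam + 1),
            if G.dist y w = 1 ∧ G.dist z w = j then c j else 0 := by
          refine Finset.sum_congr rfl fun w _ => ?_
          rw [hc, SimpleGraph.adjMatrix_apply]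
          by_cases hyw : G.Adj y w
          · rw [if_pos hyw, one_mul, Finset.sum_eq_single_of_mem (G.dist z w)
              (Finset.mem_range.2 (Nat.lt_succ_of_le (hG.dist_le z w))),
              if_pos ⟨SimpleGraph.dist_eq_one_iff_adj.2 hyw, rfl⟩, SimpleGraph.dist_comm]
            intro j _ hj
            rw [if_neg fun h => hj h.2.symm]
          · rw [if_neg hyw, zero_mul, Finset.sum_eq_zero fun j _ => ?_]
            rw [if_neg fun h => hyw (SimpleGraph.dist_eq_one_iff_adj.1 h.1)]
      _ = _ := by
          rw [Finset.sum_comm]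
          refine Finset.sum_congr rfl fun j hj => ?_
          rw [← hp _ 1 j (hG.dist_le y z) hD (Nat.lt_succ_iff.1 (Finset.mem_range.1 hj)) y z rfl,
            ← Finset.sum_filter, Finset.sum_const, nsmul_eq_mul, mul_comm]

/-- Stepping along geodesics back to one end `u` of a diametral pair meets every distance from `u`,
and spheres of equal radius around `u` and `x` have the same size. Needed for the dual eigenvalues
to be distinct on all of `0, …, D`. -/
theorem IsDistanceRegular.exists_dist_eq {X : Type*} [Fintype X] {G : SimpleGraph X}
    (hG : IsDistanceRegular G) (x : X) {i : ℕ}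
    (hi : i ≤ G.diam) : ∃ y, G.dist x y = i := by
  have : Nonempty X := ⟨x⟩
  obtain ⟨u, v, huv⟩ := G.exists_dist_eq_diam
  have hstep (k : ℕ) (hk : k ≤ G.diam) : ∃ w, G.dist u w = G.diam - k := by
    induction k with
    | zero => exact ⟨v, by simpa using huv⟩
    | succ k ih =>
      obtain ⟨w, hw⟩ := ih (by omega)
      obtain ⟨p, hp⟩ := hG.1.exists_walk_length_eq_dist w u
      cases p with
      | nil => simp at hp hw; omega
      | cons hadj p =>
        rename_i w'
        refine ⟨w', ?_⟩
        have h1 := SimpleGraph.dist_le p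
        have h2 := hG.1.dist_triangle (u := u) (v := w') (w := w)
        have h3 := SimpleGraph.dist_eq_one_iff_adj.2 hadj.symm
        rw [SimpleGraph.Walk.length_cons, SimpleGraph.dist_comm] at hp
        rw [SimpleGraph.dist_comm] at h1
        omega
  obtain ⟨w, hw⟩ := hstep (G.diam - i) (by omega)
  rw [Nat.sub_sub_self hi] at hw
  obtain ⟨p, hp⟩ := hG.2
  have h1 := hp 0 i i (Nat.zero_le _) hi hi u u SimpleGraph.dist_self
  have h2 := hp 0 i i (Nat.zero_le _) hi hi x x SimpleGraph.dist_self
  rw [← h1] at h2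
  have hpos : 0 < (Finset.univ.filter fun w : X => G.dist u w = i ∧ G.dist u w = i).card :=
    Finset.card_pos.2 ⟨w, by simp [hw]⟩
  rw [← h2] at hpos
  obtain ⟨y, hy⟩ := Finset.card_pos.1 hpos
  exact ⟨y, (Finset.mem_filter.1 hy).2.1⟩

section Resolution

variable {E : Fin (G.diam + 1) → Matrix X X ℝ} {θ : Fin (G.diam + 1) → ℝ}

open Polynomial in
theorem IsSpectralResolution.aeval_adjMatrix (h : IsSpectralResolution G E θ) (p : ℝ[X]) :
    aeval (G.adjMatrix ℝ) p = ∑ i, p.eval (θ i) • E i := by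
  have hmul (i) : aeval (G.adjMatrix ℝ) p * E i = p.eval (θ i) • E i := by
    induction p using Polynomial.induction_on' with
    | add p q hp hq => simp [add_mul, hp, hq, add_smul]
    | monomial k c =>
      have : G.adjMatrix ℝ ^ k * E i = θ i ^ k • E i := by
        induction k with
        | zero => simp
        | succ k ih =>
          rw [pow_succ', mul_assoc, ih, mul_smul_comm, h.adj_mul, smul_smul, pow_succ]
      rw [aeval_monomial, mul_assoc, this, eval_monomial, ← Algebra.smul_def, smul_smul]
  rw [← mul_one (aeval _ p), ← h.sum_eq, Finset.mul_sum]
  exact Finset.sum_congr rfl fun i _ => hmul i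

open Polynomial in
theorem IsSpectralResolution.exists_aeval_eq (h : IsSpectralResolution G E θ)
    (i : Fin (G.diam + 1)) : ∃ p : ℝ[X], aeval (G.adjMatrix ℝ) p = E i := by
  refine ⟨Lagrange.basis Finset.univ θ i, ?_⟩
  rw [h.aeval_adjMatrix, Finset.sum_eq_single_of_mem i (Finset.mem_univ i)]
  · rw [Lagrange.eval_basis_self h.inj.injOn (Finset.mem_univ i), one_smul]
  · intro j hj hji
    rw [Lagrange.eval_basis_of_ne hji.symm hj, zero_smul]

theorem IsSpectralResolution.exists_apply_eq (h : IsSpectralResolution G E θ)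
    (hG : IsDistanceRegular G) (hD : 1 ≤ G.diam) (i : Fin (G.diam + 1)) :
    ∃ c : ℕ → ℝ, ∀ y z, E i y z = c (G.dist y z) := by
  obtain ⟨p, hp⟩ := h.exists_aeval_eq i
  choose c hc using hG.exists_adjMatrix_pow_apply hD
  refine ⟨fun j => ∑ k ∈ Finset.range (p.natDegree + 1), p.coeff k * c k j, fun y z => ?_⟩
  rw [← hp, Polynomial.aeval_eq_sum_range, Matrix.sum_apply]
  exact Finset.sum_congr rfl fun k _ => by rw [Matrix.smul_apply, hc, smul_eq_mul]

/-- As `θ 0` is the valency, each row of `E 0` lies in the kernel of the Laplacian, which on a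
connected graph consists of constants. -/
theorem IsSpectralResolution.zero_apply_eq (h : IsSpectralResolution G E θ)
    (hG : IsDistanceRegular G) (x y z : X) : E 0 x y = E 0 x z := by
  have hlap : G.lapMatrix ℝ *ᵥ (E 0 x) = 0 := by
    ext w
    have h1 := congrFun (congrFun (h.mul_adj 0) x) w
    rw [Matrix.mul_apply, Matrix.smul_apply, smul_eq_mul, ← h.degree_eq w] at h1
    rw [SimpleGraph.lapMatrix_mulVec_apply, Pi.zero_apply, ← h1, sub_eq_zero]
    simp [SimpleGraph.adjMatrix_apply, SimpleGraph.neighborFinset_eq_filter, Finset.sum_filter,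
      G.adj_comm]
  exact (G.lapMatrix_mulVec_eq_zero_iff_forall_reachable).1 hlap y z (hG.1.preconnected y z)

end Resolution

/-- Vertices that the row of `x` in `E 1` does not separate are not separated by the row of `x` in
any `E i`. -/
theorem IsQPolynomialOrdering.row_eq {E : Fin (G.diam + 1) → Matrix X X ℝ}
    (hE : IsQPolynomialOrdering G E) (hG : IsDistanceRegular G) (hD : 1 ≤ G.diam) {x y z : X}
    (h1 : E 1 x y = E 1 x z) (i : Fin (G.diam + 1)) : E i x y = E i x z := by
  obtain ⟨hE, q, hq, hq0, hq1⟩ := hE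
  obtain ⟨θ, h⟩ := hE.exists_isSpectralResolution
  have h1v : ((1 : Fin (G.diam + 1)) : ℕ) = 1 := by
    rw [Fin.val_one', Nat.mod_eq_of_lt (by omega)]
  have key (k : ℕ) : ∀ hk : k < G.diam + 1, E ⟨k, hk⟩ x y = E ⟨k, hk⟩ x z := by
    induction k using Nat.strong_induction_on with
    | _ k ih =>
      intro hk
      rcases k with _ | k
      · exact h.zero_apply_eq hG x y z
      -- In `E 1 ⊙ E k` only idempotents of index at most `k + 1` occur, and `E (k + 1)` has a
      -- nonzero coefficient, so it can be solved for.
      have hprod := hq 1 ⟨k, by omega⟩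
      have hy := congrFun (congrFun hprod x) y
      have hz := congrFun (congrFun hprod x) z
      rw [Matrix.hadamard_apply, Matrix.smul_apply, Matrix.sum_apply] at hy hz
      have : Nonempty X := ⟨x⟩
      have hX : (Fintype.card X : ℝ)⁻¹ ≠ 0 := inv_ne_zero (Nat.cast_ne_zero.2 Fintype.card_ne_zero)
      rw [h1, ih k k.lt_succ_self, hz] at hy
      have hsum := smul_right_injective ℝ hX hy
      simp only [Matrix.smul_apply, smul_eq_mul] at hsum
      rw [← sub_eq_zero, ← Finset.sum_sub_distrib,
        Finset.sum_eq_single_of_mem ⟨k + 1, hk⟩ (Finset.mem_univ _), ← mul_sub] at hsum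
      · have := (mul_eq_zero.1 hsum).resolve_left
          (hq1 _ _ _ (Or.inl (by rw [h1v]; simp; omega)))
        linarith
      · intro l _ hl
        have hlk : (l : ℕ) ≠ k + 1 := fun h => hl (Fin.ext h)
        rcases lt_or_gt_of_ne hlk with hlt | hgt
        · rw [ih l hlt l.2, sub_self]
        · rw [hq0 l 1 ⟨k, by omega⟩ (Or.inl (by rw [h1v]; simp; omega)), zero_mul, zero_mul,
            sub_self]
  exact key i i.2

/-- Distinct distances from `x` are separated by the row of `x` in `E 1`. -/
theorem IsQPolynomialOrdering.dist_eq {E : Fin (G.diam + 1) → Matrix X X ℝ}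
    (hE : IsQPolynomialOrdering G E) (hG : IsDistanceRegular G) (hD : 1 ≤ G.diam) {x y z : X}
    (h1 : E 1 x y = E 1 x z) : G.dist x y = G.dist x z := by
  obtain ⟨θ, h⟩ := hE.1.exists_isSpectralResolution
  have hle {y z : X} (h1 : E 1 x y = E 1 x z) : G.dist x z ≤ G.dist x y := by
    by_contra! hlt
    -- Powers of the adjacency matrix are combinations of the `E i`, so their rows at `x` do not
    -- separate `y` from `z`. Yet a walk of length `G.dist x y` reaches `y` and is too short to
    -- reach `z`.
    have hpow : (G.adjMatrix ℝ ^ G.dist x y) x y = (G.adjMatrix ℝ ^ G.dist x y) x z := by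
      rw [← Polynomial.aeval_X_pow (R := ℝ), h.aeval_adjMatrix, Matrix.sum_apply, Matrix.sum_apply]
      exact Finset.sum_congr rfl fun i _ => by
        rw [Matrix.smul_apply, Matrix.smul_apply, hE.row_eq hG hD h1 i]
    rw [SimpleGraph.adjMatrix_pow_apply_eq_card_walk, SimpleGraph.adjMatrix_pow_apply_eq_card_walk,
      Nat.cast_inj] at hpow
    obtain ⟨p, hp⟩ := hG.1.exists_walk_length_eq_dist x y
    have hpos : 0 < Fintype.card {p : G.Walk x y | p.length = G.dist x y} :=
      Fintype.card_pos_iff.2 ⟨⟨p, hp⟩⟩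
    rw [hpow] at hpos
    obtain ⟨⟨p', hp'⟩⟩ := Fintype.card_pos_iff.1 hpos
    have := SimpleGraph.dist_le p'
    rw [Set.mem_ofPred_eq] at hp'
    omega
  exact le_antisymm (hle h1.symm) (hle h1)

/-- The triple product relation: `E i * A^* * E j = 0` unless `|i - j| ≤ 1`, where `A^*` is the
diagonal matrix whose diagonal is the row of `x` in `E 1`. -/
theorem IsQPolynomialOrdering.mul_diagonal_mul_eq_zero {E : Fin (G.diam + 1) → Matrix X X ℝ}
    (hE : IsQPolynomialOrdering G E) (hD : 1 ≤ G.diam) (x : X) (i j : Fin (G.diam + 1))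
    (hij : (i : ℕ) + 1 < j ∨ (j : ℕ) + 1 < i) :
    E i * Matrix.diagonal (E 1 x) * E j = 0 := by
  obtain ⟨hE, q, hq, hq0, -⟩ := hE
  obtain ⟨θ, h⟩ := hE.exists_isSpectralResolution
  have h1v : ((1 : Fin (G.diam + 1)) : ℕ) = 1 := by
    rw [Fin.val_one', Nat.mod_eq_of_lt (by omega)]
  have hidem (k) : E k * E k = E k := by
    conv_rhs => rw [← mul_one (E k), ← h.sum_eq, Finset.mul_sum]
    exact (Finset.sum_eq_single_of_mem k (Finset.mem_univ k)
      fun l _ hl => h.mul_of_ne k l hl.symm).symm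
  have hsymm (k) (y z : X) : E k y z = E k z y := congrFun (congrFun (h.transpose_eq k) z) y
  -- This trace equals the squared Frobenius norm of `E i * A^* * E j`. Expanding `E i ⊙ E j` leaves
  -- only the term `h = 1`, whose coefficient `q 1 i j` vanishes.
  have htrace : (E i * Matrix.diagonal (E 1 x) * E j * Matrix.diagonal (E 1 x)).trace = 0 := by
    have hentry (h : Fin (G.diam + 1)) : (E 1 * E h * E 1) x x =
        ∑ y, ∑ z, E 1 x z * E h z y * E 1 x y := by
      rw [Matrix.mul_apply]
      refine Finset.sum_congr rfl fun y _ => ?_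
      rw [Matrix.mul_apply, Finset.sum_mul, hsymm 1 y x]
    calc _ = ∑ y, ∑ z, (E i ⊙ E j) z y * (E 1 x z * E 1 x y) := by
          rw [Matrix.trace]
          refine Finset.sum_congr rfl fun y _ => ?_
          rw [Matrix.diag_apply, Matrix.mul_diagonal, Matrix.mul_apply, Finset.sum_mul]
          refine Finset.sum_congr rfl fun z _ => ?_
          rw [Matrix.mul_diagonal, Matrix.hadamard_apply, hsymm i y z]
          ring
      _ = (Fintype.card X : ℝ)⁻¹ * ∑ h, q h i j * (E 1 * E h * E 1) x x := by
          rw [hq]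
          simp only [hentry, Matrix.smul_apply, Matrix.sum_apply, smul_eq_mul, Finset.mul_sum,
            Finset.sum_mul]
          conv_rhs => rw [Finset.sum_comm]
          refine Finset.sum_congr rfl fun y _ => ?_
          conv_rhs => rw [Finset.sum_comm]
          refine Finset.sum_congr rfl fun z _ => Finset.sum_congr rfl fun l _ => ?_
          ring
      _ = 0 := by
          rw [Finset.sum_eq_zero, mul_zero]
          intro l _
          by_cases hl : l = 1
          · rw [hl, hq0 1 i j (by rw [h1v]; omega), zero_mul]
          · rw [h.mul_of_ne 1 l (Ne.symm hl), zero_mul, Matrix.zero_apply, mul_zero]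
  set N := E i * Matrix.diagonal (E 1 x) * E j with hN
  have hNT : Nᵀ = E j * Matrix.diagonal (E 1 x) * E i := by
    rw [hN, Matrix.transpose_mul, Matrix.transpose_mul, h.transpose_eq, h.transpose_eq,
      Matrix.diagonal_transpose, mul_assoc]
  have hNN : (N.conjTranspose * N).trace = 0 := by
    rw [Matrix.conjTranspose_eq_transpose_of_trivial, hNT, ← htrace, hN, Matrix.trace_mul_comm]
    have : E i * Matrix.diagonal (E 1 x) * E j * (E j * Matrix.diagonal (E 1 x) * E i) =
        (E i * Matrix.diagonal (E 1 x) * E j * Matrix.diagonal (E 1 x)) * E i := by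
      conv_rhs => rw [← hidem j]
      simp only [mul_assoc]
    rw [this, Matrix.trace_mul_comm]
    conv_rhs => rw [← hidem i]
    simp only [mul_assoc]
  exact Matrix.trace_conjTranspose_mul_self_eq_zero_iff.1 hNN

end DistanceRegular

/-! ### Moving tridiagonal pairs between algebras; common eigenvectors. -/

section Transport

variable {K R S : Type*} [Field K] [Ring R] [Algebra K R] [Ring S] [Algebra K S]
  {a b : R} {n : ℕ} {θ : ℕ → K} {e : ℕ → R}

theorem IsTridiagonal.map (h : IsTridiagonal a b n θ e) (φ : R →ₐ[K] S) :
    IsTridiagonal (φ a) (φ b) n θ fun i => φ (e i) where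
  inj := h.inj
  mul_e i := by rw [← map_mul, h.mul_e, map_smul]
  e_mul i := by rw [← map_mul, h.e_mul, map_smul]
  sum_e := by rw [← map_sum, h.sum_e, map_one]
  tri i j hij := by rw [← map_mul, ← map_mul, h.tri i j hij, map_zero]

/-- Brings relations between full matrices down to the Terwilliger algebra, from which
`IsTridiagonal.map` carries them to endomorphisms of a module. -/
theorem IsTridiagonal.of_map {φ : R →ₐ[K] S} (hφ : Function.Injective φ)
    (h : IsTridiagonal (φ a) (φ b) n θ fun i => φ (e i)) : IsTridiagonal a b n θ e where
  inj := h.inj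
  mul_e i := hφ (by rw [map_mul, h.mul_e, map_smul])
  e_mul i := hφ (by rw [map_mul, h.e_mul, map_smul])
  sum_e := hφ (by rw [map_sum, h.sum_e, map_one])
  tri i j hij := hφ (by rw [map_mul, map_mul, h.tri i j hij, map_zero])

/-- Puts the first idempotent that acts nontrivially on a module in position `0`, where the corner
results apply. -/
theorem IsTridiagonal.shift (h : IsTridiagonal a b n θ e) {r : ℕ} (hr : r ≤ n)
    (hz : ∀ i < r, e i = 0) :
    IsTridiagonal a b (n - r) (fun i => θ (r + i)) fun i => e (r + i) where
  inj i hi j hj hij := by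
    have hi' : i < n - r := by simpa using hi
    have hj' : j < n - r := by simpa using hj
    have := h.inj (by simp; omega : r + i ∈ (Finset.range n : Set ℕ))
      (by simp; omega : r + j ∈ (Finset.range n : Set ℕ)) hij
    omega
  mul_e i := h.mul_e _
  e_mul i := h.e_mul _
  sum_e := by
    rw [← h.sum_e]
    conv_rhs => rw [← Nat.add_sub_cancel' hr, Finset.sum_range_add]
    rw [Finset.sum_eq_zero fun i hi => hz i (Finset.mem_range.1 hi), zero_add]
  tri i j hij := h.tri _ _ (by omega)

end Transport

variable {X : Type*} [Fintype X] [DecidableEq X]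

/-- Symmetric matrices that commute on an invariant nonzero subspace have a common eigenvector
there. -/
theorem exists_common_eigenvector {ι : Type*} {B : ι → Matrix X X ℝ} (hB : ∀ i, (B i)ᵀ = B i)
    {H : Submodule ℝ (X → ℝ)} (hH : H ≠ ⊥) (hinv : ∀ i, ∀ v ∈ H, B i *ᵥ v ∈ H)
    (hcomm : ∀ i j, ∀ v ∈ H, B i *ᵥ B j *ᵥ v = B j *ᵥ B i *ᵥ v) :
    ∃ u ∈ H, u ≠ 0 ∧ ∀ i, ∃ c : ℝ, B i *ᵥ u = c • u := by
  -- With the Euclidean inner product the restrictions are commuting symmetric operators, so their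
  -- joint eigenspaces, with real eigenvalues, span.
  let H' : Submodule ℝ (EuclideanSpace ℝ X) :=
    H.comap (WithLp.linearEquiv 2 ℝ (X → ℝ)).toLinearMap
  have hinv' (i : ι) : ∀ v ∈ H', Matrix.toEuclideanLin (B i) v ∈ H' := fun v hv => hinv i _ hv
  let T (i : ι) : H' →ₗ[ℝ] H' := (Matrix.toEuclideanLin (B i)).restrict (hinv' i)
  have hT (i : ι) : (T i).IsSymmetric := by
    refine LinearMap.IsSymmetric.restrict_invariant ?_ (hinv' i)
    rw [Matrix.isSymmetric_toEuclideanLin_iff, Matrix.IsHermitian,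
      Matrix.conjTranspose_eq_transpose_of_trivial, hB]
  have hTc : Pairwise (Function.onFun Commute T) := by
    intro i j _
    ext v : 2
    exact congrArg (WithLp.toLp 2) (hcomm i j _ v.2)
  have htop := LinearMap.IsSymmetric.iSup_iInf_eq_top_of_commute hT hTc
  obtain ⟨v, hv, hv0⟩ := (Submodule.ne_bot_iff H).1 hH
  have hne : (⊤ : Submodule ℝ H') ≠ ⊥ := by
    refine (Submodule.ne_bot_iff _).2 ⟨⟨WithLp.toLp 2 v, hv⟩, trivial, fun h => hv0 ?_⟩
    simpa using congrArg Subtype.val h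
  rw [← htop, Ne, iSup_eq_bot, not_forall] at hne
  obtain ⟨χ, hχ⟩ := hne
  obtain ⟨u, hu, hu0⟩ := (Submodule.ne_bot_iff _).1 hχ
  refine ⟨WithLp.ofLp (u : EuclideanSpace ℝ X), u.2, fun h => hu0 ?_, fun i => ⟨χ i, ?_⟩⟩
  · ext y
    exact congrFun h y
  · have := Module.End.mem_eigenspace_iff.1 ((Submodule.mem_iInf _).1 hu i)
    exact congrArg (fun w : H' => WithLp.ofLp (w : EuclideanSpace ℝ X)) this

variable {G : SimpleGraph X} [DecidableRel G.Adj]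

theorem dualIdempotent_mem_terwilliger (hG : IsDistanceRegular G) (x : X) (j : ℕ) :
    dualIdempotent ℝ G x j ∈ terwilliger ℝ G x := by
  by_cases hj : j ≤ G.diam
  · exact Algebra.subset_adjoin (Or.inr ⟨j, hj, rfl⟩)
  · have : dualIdempotent ℝ G x j = 0 := by
      rw [dualIdempotent, ← Matrix.diagonal_zero]
      congr 1
      ext y
      rw [if_neg]
      have := hG.dist_le x y
      omega
    rw [this]
    exact zero_mem _

theorem adjMatrix_mem_terwilliger (G : SimpleGraph X) [DecidableRel G.Adj] (x : X) :
    G.adjMatrix ℝ ∈ terwilliger ℝ G x := Algebra.subset_adjoin (Or.inl rfl)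

/-! ### The tridiagonal pair of the Terwilliger algebra and its rank-one idempotent. -/

section Pair

variable {E : Fin (G.diam + 1) → Matrix X X ℝ}

theorem IsQPolynomialOrdering.exists_isTridiagonal_adjMatrix (hE : IsQPolynomialOrdering G E)
    (hD : 1 ≤ G.diam) (x : X) :
    ∃ θ : ℕ → ℝ, IsTridiagonal (G.adjMatrix ℝ) (Matrix.diagonal (E 1 x)) (G.diam + 1) θ
      fun k => if hk : k < G.diam + 1 then E ⟨k, hk⟩ else 0 := by
  obtain ⟨θ, h⟩ := hE.1.exists_isSpectralResolution
  refine ⟨fun k => if hk : k < G.diam + 1 then θ ⟨k, hk⟩ else 0, ?_, ?_, ?_, ?_, ?_⟩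
  · intro i hi j hj hij
    have hi' : i < G.diam + 1 := by simpa using hi
    have hj' : j < G.diam + 1 := by simpa using hj
    simp only [dif_pos hi', dif_pos hj'] at hij
    simpa using h.inj hij
  · intro i
    split_ifs
    · exact h.adj_mul _
    · simp
  · intro i
    split_ifs
    · exact h.mul_adj _
    · simp
  · rw [Finset.sum_range, ← h.sum_eq]
    exact Finset.sum_congr rfl fun i _ => dif_pos i.2
  · intro i j hij
    by_cases hi : i < G.diam + 1
    · by_cases hj : j < G.diam + 1
      · rw [dif_pos hi, dif_pos hj]
        exact hE.mul_diagonal_mul_eq_zero hD x _ _ hij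
      · rw [dif_neg hj, mul_zero]
    · rw [dif_neg hi, zero_mul, zero_mul]

theorem IsQPolynomialOrdering.exists_isTridiagonal_diagonal (hE : IsQPolynomialOrdering G E)
    (hG : IsDistanceRegular G) (hD : 1 ≤ G.diam) (x : X) :
    ∃ θ : ℕ → ℝ, IsTridiagonal (Matrix.diagonal (E 1 x)) (G.adjMatrix ℝ) (G.diam + 1) θ
      (dualIdempotent ℝ G x) := by
  obtain ⟨θ, h⟩ := hE.1.exists_isSpectralResolution
  obtain ⟨c, hc⟩ := h.exists_apply_eq hG hD 1
  have hmul (i : ℕ) : Matrix.diagonal (E 1 x) * dualIdempotent ℝ G x i =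
      c i • dualIdempotent ℝ G x i := by
    rw [dualIdempotent, Matrix.diagonal_mul_diagonal, ← Matrix.diagonal_smul]
    congr 1
    ext y
    by_cases hy : G.dist x y = i <;> simp [hc, hy]
  refine ⟨c, ?_, hmul, fun i => ?_, ?_, fun i j hij => ?_⟩
  · intro i hi j hj hij
    have hi' : i < G.diam + 1 := by simpa using hi
    have hj' : j < G.diam + 1 := by simpa using hj
    -- Both indices are realized as distances from `x`, so equality of dual eigenvalues is equality
    -- of entries in the row of `E 1`.
    obtain ⟨y, rfl⟩ := hG.exists_dist_eq x (Nat.lt_succ_iff.1 hi')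
    obtain ⟨z, rfl⟩ := hG.exists_dist_eq x (Nat.lt_succ_iff.1 hj')
    exact hE.dist_eq hG hD (by rw [hc, hc, hij])
  · rw [← hmul, dualIdempotent, Matrix.diagonal_mul_diagonal, Matrix.diagonal_mul_diagonal]
    congr 1
    ext y
    exact mul_comm _ _
  · ext y z
    rw [Matrix.sum_apply, Matrix.one_apply]
    simp only [dualIdempotent, Matrix.diagonal_apply]
    by_cases hyz : y = z
    · subst hyz
      simp [Nat.lt_succ_of_le (hG.dist_le x y)]
    · simp [hyz]
  · ext y z
    rw [dualIdempotent, dualIdempotent, Matrix.mul_diagonal, Matrix.diagonal_mul,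
      SimpleGraph.adjMatrix_apply, Matrix.zero_apply]
    -- Adjacent vertices differ by at most one in their distance from `x`.
    by_cases hyz : G.Adj y z
    · have h1 := SimpleGraph.dist_eq_one_iff_adj.2 hyz
      have h2 := SimpleGraph.dist_eq_one_iff_adj.2 hyz.symm
      have h3 := hG.1.dist_triangle (u := x) (v := y) (w := z)
      have h4 := hG.1.dist_triangle (u := x) (v := z) (w := y)
      by_cases hy : G.dist x y = i
      · rw [if_neg (by omega : G.dist x z ≠ j), mul_zero]
      · rw [if_neg hy, zero_mul, zero_mul]
    · rw [if_neg hyz, mul_zero, zero_mul]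

theorem IsQPolynomialOrdering.diagonal_mem_terwilliger (hE : IsQPolynomialOrdering G E)
    (hG : IsDistanceRegular G) (hD : 1 ≤ G.diam) (x : X) :
    Matrix.diagonal (E 1 x) ∈ terwilliger ℝ G x := by
  obtain ⟨θ, h⟩ := hE.exists_isTridiagonal_diagonal hG hD x
  have := h.aeval_eq Polynomial.X
  rw [Polynomial.aeval_X] at this
  rw [this]
  exact sum_mem fun i _ => Subalgebra.smul_mem _ (dualIdempotent_mem_terwilliger hG x i) _

/-- The dual eigenvalues are distinct, so each dual idempotent is a polynomial in the single
diagonal matrix. -/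
theorem IsQPolynomialOrdering.terwilliger_le (hE : IsQPolynomialOrdering G E)
    (hG : IsDistanceRegular G) (hD : 1 ≤ G.diam) (x : X) :
    terwilliger ℝ G x ≤ Algebra.adjoin ℝ {G.adjMatrix ℝ, Matrix.diagonal (E 1 x)} := by
  refine Algebra.adjoin_le ?_
  rintro B (hB | ⟨i, hi, rfl⟩)
  · rw [Set.mem_singleton_iff.1 hB]
    exact Algebra.subset_adjoin (Set.mem_insert _ _)
  · obtain ⟨θ, h⟩ := hE.exists_isTridiagonal_diagonal hG hD x
    obtain ⟨p, hp⟩ := h.exists_aeval_eq_e (Nat.lt_succ_of_le hi)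
    rw [← hp]
    exact Algebra.adjoin_mono (by simp) (Polynomial.aeval_mem_adjoin_singleton ℝ _)

/-- The action of the Terwilliger algebra on an invariant subspace of the standard module. -/
noncomputable def actionOn (x : X) (W : Submodule ℝ (X → ℝ))
    (hinv : ∀ t ∈ terwilliger ℝ G x, ∀ v ∈ W, t *ᵥ v ∈ W) :
    terwilliger ℝ G x →ₐ[ℝ] Module.End ℝ W :=
  AlgHom.ofLinearMap
    { toFun := fun t => (Matrix.toLin' (t : Matrix X X ℝ)).restrict (hinv t t.2)
      map_add' := fun s t => by
        ext v : 2
        exact Matrix.add_mulVec _ _ _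
      map_smul' := fun c t => by
        ext v : 2
        exact Matrix.smul_mulVec _ _ _ }
    (by
      ext v : 2
      exact Matrix.one_mulVec _)
    (fun s t => by
      ext v : 2
      exact (Matrix.mulVec_mulVec _ _ _).symm)

/-- On an irreducible module, the first nonzero dual primitive idempotent has rank one. -/
theorem exists_dualIdempotent_mulVec_eq (hG : IsDistanceRegular G) (hD : 1 ≤ G.diam)
    (hE : IsQPolynomialOrdering G E) (x : X) {W : Submodule ℝ (X → ℝ)} (hW : W ≠ ⊥)
    (hinv : ∀ t ∈ terwilliger ℝ G x, ∀ v ∈ W, t *ᵥ v ∈ W)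
    (hirr : ∀ u ∈ W, u ≠ 0 → ∀ w ∈ W, ∃ t ∈ terwilliger ℝ G x, t *ᵥ u = w) :
    ∃ r, ∃ u ∈ W, u ≠ 0 ∧ dualIdempotent ℝ G x r *ᵥ u = u ∧
      ∀ w ∈ W, ∃ c : ℝ, dualIdempotent ℝ G x r *ᵥ w = c • u := by
  have hnt : Nontrivial W := Submodule.nontrivial_iff_ne_bot.2 hW
  obtain ⟨θ, h⟩ := hE.exists_isTridiagonal_adjMatrix hD x
  obtain ⟨θ', h'⟩ := hE.exists_isTridiagonal_diagonal hG hD x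
  obtain ⟨θ₁, hE'⟩ := hE.1.exists_isSpectralResolution
  let A : terwilliger ℝ G x := ⟨_, adjMatrix_mem_terwilliger G x⟩
  let B : terwilliger ℝ G x := ⟨_, hE.diagonal_mem_terwilliger hG hD x⟩
  let F (j : ℕ) : terwilliger ℝ G x := ⟨_, dualIdempotent_mem_terwilliger hG x j⟩
  have hEmem (k : ℕ) : (if hk : k < G.diam + 1 then E ⟨k, hk⟩ else 0) ∈ terwilliger ℝ G x := by
    split_ifs with hk
    · obtain ⟨p, hp⟩ := hE'.exists_aeval_eq ⟨k, hk⟩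
      rw [← hp]
      exact Algebra.adjoin_le (Set.singleton_subset_iff.2 (adjMatrix_mem_terwilliger G x))
        (Polynomial.aeval_mem_adjoin_singleton ℝ _)
    · exact zero_mem _
  let e (k : ℕ) : terwilliger ℝ G x := ⟨_, hEmem k⟩
  have hT : IsTridiagonal A B (G.diam + 1) θ e :=
    IsTridiagonal.of_map (φ := (terwilliger ℝ G x).val) Subtype.val_injective h
  have hT' : IsTridiagonal B A (G.diam + 1) θ' F :=
    IsTridiagonal.of_map (φ := (terwilliger ℝ G x).val) Subtype.val_injective h'
  let ρ : terwilliger ℝ G x →ₐ[ℝ] Module.End ℝ W := actionOn x W hinv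
  have hρT := hT.map (S := Module.End ℝ W) ρ
  have hρT' := hT'.map (S := Module.End ℝ W) ρ
  have hex : ∃ r, r < G.diam + 1 ∧ ρ (F r) ≠ 0 := by
    by_contra! hall
    have := hρT'.sum_e
    rw [Finset.sum_eq_zero fun i hi => hall i (Finset.mem_range.1 hi)] at this
    exact zero_ne_one this
  classical
  obtain ⟨hr, hFr⟩ := Nat.find_spec hex
  set r := Nat.find hex
  have hbelow : ∀ i < r, ρ (F i) = 0 := fun i hi => by
    by_contra hne
    exact Nat.find_min hex hi ⟨by omega, hne⟩
  have hS := hρT'.shift hr.le hbelow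
  have hpos : 0 < G.diam + 1 - r := by omega
  have hidem : F r * F r = F r := by
    refine Subtype.ext ?_
    change dualIdempotent ℝ G x r * dualIdempotent ℝ G x r = dualIdempotent ℝ G x r
    rw [dualIdempotent, Matrix.diagonal_mul_diagonal]
    congr 1
    ext y
    split_ifs <;> simp
  have hmul (s t : terwilliger ℝ G x) (w : W) : ρ s (ρ t w) = ρ (s * t) w := by
    rw [map_mul, Module.End.mul_apply]
  have hcomm (k l : ℕ) : F r * e k * F r * e l * F r - F r * e l * F r * e k * F r ∈
      RingHom.ker ρ := by
    rw [RingHom.mem_ker, map_sub, sub_eq_zero]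
    by_cases hk : k < G.diam + 1
    · by_cases hl : l < G.diam + 1
      · obtain ⟨p, hp⟩ := hρT.exists_aeval_eq_e hk
        obtain ⟨q, hq⟩ := hρT.exists_aeval_eq_e hl
        have := hρT.corner_commute hS hpos p q
        rw [hp, hq] at this
        simpa only [add_zero, ← map_mul] using this
      · have : e l = 0 := Subtype.ext (dif_neg hl)
        simp [this]
    · have : e k = 0 := Subtype.ext (dif_neg hk)
      simp [this]
  -- `H` is `E_r^* W`, placed in the standard module so that symmetry of the matrices can be used.
  let H : Submodule ℝ (X → ℝ) := (LinearMap.range (ρ (F r))).map W.subtype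
  have hHmem (v : X → ℝ) : v ∈ H ↔ ∃ w : W, ρ (F r) w = w ∧ (w : X → ℝ) = v := by
    constructor
    · rintro ⟨_, ⟨w, rfl⟩, rfl⟩
      exact ⟨ρ (F r) w, by rw [hmul, hidem], rfl⟩
    · rintro ⟨w, hw, rfl⟩
      exact ⟨w, ⟨w, hw⟩, rfl⟩
  have hbot : H ≠ ⊥ := by
    intro hbot
    refine hFr (LinearMap.ext fun w => ?_)
    have : (ρ (F r) w : X → ℝ) ∈ H := ⟨_, ⟨w, rfl⟩, rfl⟩
    rw [hbot, Submodule.mem_bot] at this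
    exact Subtype.ext this
  have heT (k : ℕ) : (e k : Matrix X X ℝ)ᵀ = e k := by
    change (dite _ _ _ : Matrix X X ℝ)ᵀ = dite _ _ _
    split_ifs
    · exact hE'.transpose_eq _
    · exact Matrix.transpose_zero
  obtain ⟨v, hv, hv0, hvc⟩ := exists_common_eigenvector
    (B := fun k => ((F r * e k * F r : terwilliger ℝ G x) : Matrix X X ℝ)) (H := H)
    (fun k => by
      change (dualIdempotent ℝ G x r * _ * dualIdempotent ℝ G x r)ᵀ =
        dualIdempotent ℝ G x r * _ * dualIdempotent ℝ G x r
      rw [Matrix.transpose_mul, Matrix.transpose_mul, dualIdempotent, Matrix.diagonal_transpose,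
        mul_assoc, heT]) hbot
    (fun k v hv => by
      obtain ⟨w, hw, rfl⟩ := (hHmem v).1 hv
      refine (hHmem _).2 ⟨ρ (F r * e k * F r) w, ?_, rfl⟩
      rw [hmul, ← mul_assoc, ← mul_assoc, hidem])
    (fun k l v hv => by
      obtain ⟨w, hw, rfl⟩ := (hHmem v).1 hv
      have h1 : ρ (F r * e k * F r) (ρ (F r * e l * F r) w) =
          ρ (F r * e l * F r) (ρ (F r * e k * F r) w) := by
        have hassoc (k l : ℕ) : F r * e k * F r * (F r * e l * F r) =
            F r * e k * F r * e l * F r := by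
          rw [← mul_assoc, ← mul_assoc, mul_assoc (F r * e k), hidem]
        have h2 := hcomm k l
        rw [RingHom.mem_ker, map_sub, sub_eq_zero] at h2
        rw [hmul, hmul, hassoc, hassoc, h2]
      exact congrArg Subtype.val h1)
  obtain ⟨u, hu, rfl⟩ := (hHmem v).1 hv
  refine ⟨r, u, u.2, hv0, congrArg Subtype.val hu, fun w hw => ?_⟩
  obtain ⟨t, ht, rfl⟩ := hirr u u.2 hv0 w hw
  have hadj : ρ ⟨t, ht⟩ ∈ Algebra.adjoin ℝ {ρ A, ρ B} := by
    have h1 : t ∈ (Algebra.adjoin ℝ {A, B}).map (terwilliger ℝ G x).val := by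
      rw [AlgHom.map_adjoin, Set.image_pair]
      exact hE.terwilliger_le hG hD x ht
    obtain ⟨s, hs, rfl⟩ := h1
    rw [← Set.image_pair, ← AlgHom.map_adjoin]
    exact ⟨s, hs, rfl⟩
  -- The line of `u` is stable under the corners of polynomials in `A`, hence under the corner of
  -- `t`; as `w = t *ᵥ u`, this confines `E_r^* w` to that line.
  have hspan := hρT.smul_mem_of_mem_adjoin hS hpos (M := ℝ ∙ u) (m := u) ?_ ?_ hadj
    (Submodule.mem_span_singleton_self u)
  · obtain ⟨c, hc⟩ := Submodule.mem_span_singleton.1 hspan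
    exact ⟨c, (congrArg Subtype.val hc).symm⟩
  · intro m hm
    obtain ⟨c, rfl⟩ := Submodule.mem_span_singleton.1 hm
    rw [smul_comm]
    exact congrArg (c • ·) hu
  · intro p m hm
    obtain ⟨c, rfl⟩ := Submodule.mem_span_singleton.1 hm
    rw [smul_comm _ c, smul_comm _ c]
    refine Submodule.smul_mem _ c ?_
    -- A polynomial in `A` acts as a combination of the `e k`, and `u` is an eigenvector of every `F
    -- r * e k * F r`.
    rw [hρT.aeval_eq, Finset.sum_smul, Finset.smul_sum]
    refine Submodule.sum_mem _ fun k _ => ?_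
    rw [smul_assoc, smul_comm]
    refine Submodule.smul_mem _ _ ?_
    obtain ⟨d, hd⟩ := hvc k
    have hd' : ρ (F r * e k * F r) u = d • u := Subtype.ext hd
    rw [← hmul, hu, ← hmul] at hd'
    exact Submodule.mem_span_singleton.2 ⟨d, hd'.symm⟩

end Pair

/-! ### From a rank-one projection to irreducibility of the complexification. -/

section Irreducible

variable {x : X} {W : Submodule (terwilliger ℝ G x) (X → ℝ)}

theorem map_ofReal_mem_terwilliger {B : Matrix X X ℝ} (hB : B ∈ terwilliger ℝ G x) :
    B.map Complex.ofReal ∈ terwilliger ℂ G x := by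
  unfold terwilliger at hB
  induction hB using Algebra.adjoin_induction with
  | mem B hB =>
    rcases hB with hB | ⟨i, hi, rfl⟩
    · rw [Set.mem_singleton_iff.1 hB]
      have : (G.adjMatrix ℝ).map Complex.ofReal = G.adjMatrix ℂ := by
        ext a b; by_cases h : G.Adj a b <;> simp [h]
      rw [this]
      exact Algebra.subset_adjoin (Or.inl rfl)
    · have : (dualIdempotent ℝ G x i).map Complex.ofReal = dualIdempotent ℂ G x i := by
        ext a b
        by_cases h : a = b <;> by_cases h' : G.dist x b = i <;> simp [dualIdempotent, h, h']
      rw [this]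
      exact Algebra.subset_adjoin (Or.inr ⟨i, hi, rfl⟩)
  | algebraMap r =>
    have : (algebraMap ℝ (Matrix X X ℝ) r).map Complex.ofReal
        = algebraMap ℂ (Matrix X X ℂ) r := by
      ext a b; by_cases h : a = b <;> simp [Matrix.algebraMap_matrix_apply, h]
    rw [this]
    exact Subalgebra.algebraMap_mem _ _
  | add B C _ _ hB hC =>
    have : (B + C).map Complex.ofReal = B.map Complex.ofReal + C.map Complex.ofReal := by
      ext; simp
    rw [this]
    exact add_mem hB hC
  | mul B C _ _ hB hC =>
    have : (B * C).map Complex.ofReal = B.map Complex.ofReal * C.map Complex.ofReal := by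
      ext; simp [Matrix.mul_apply]
    rw [this]
    exact mul_mem hB hC

/-- A member of `T^ℝ`, as a member of `T^ℂ`. -/
noncomputable def complexify (B : terwilliger ℝ G x) : terwilliger ℂ G x :=
  ⟨_, map_ofReal_mem_terwilliger B.2⟩

theorem complexify_smul_tmul (B : terwilliger ℝ G x) (c : ℂ) (w : W) :
    complexify B • (c ⊗ₜ[ℝ] w) = c ⊗ₜ[ℝ] (B • w) := by
  have hre : rePart (complexify B) = B := by
    ext a b; simp [rePart, complexify]
  have him : imPart (complexify B) = 0 := by
    ext a b; simp [imPart, complexify]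
  rw [complexification_smul_tmul, hre, him, zero_smul, TensorProduct.tmul_zero, add_zero]

/-- Ensures that `T^ℂ`-submodules are closed under complex scalars acting on the first tensor
factor. -/
theorem algebraMap_smul_complexification (c : ℂ) (z : ℂ ⊗[ℝ] W) :
    algebraMap ℂ (terwilliger ℂ G x) c • z = c • z := by
  apply complexificationMap_injective
  rw [complexificationMap_smul, map_smul, algebraMap_smul]

set_option synthInstance.maxHeartbeats 200000 in
/-- The complexification of an irreducible module is irreducible if some `F` in the Terwilliger
algebra acts on the module as a projection of rank one. -/
theorem isSimpleModule_complexification {F : terwilliger ℝ G x} {u : W} (hu0 : u ≠ 0)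
    (hu : F • u = u) (hF : ∀ w : W, ∃ c : ℝ, F • w = c • u)
    (hirr : ∀ v : W, v ≠ 0 → ∀ w : W, ∃ t : terwilliger ℝ G x, t • v = w) :
    IsSimpleModule (terwilliger ℂ G x) (ℂ ⊗[ℝ] W) := by
  have hsmul (N : Submodule (terwilliger ℂ G x) (ℂ ⊗[ℝ] W)) (c : ℂ) {z : ℂ ⊗[ℝ] W} (hz : z ∈ N) :
      c • z ∈ N := by
    rw [← algebraMap_smul_complexification]
    exact N.smul_mem _ hz
  have htop (N : Submodule (terwilliger ℂ G x) (ℂ ⊗[ℝ] W)) (hN : (1 : ℂ) ⊗ₜ[ℝ] u ∈ N) :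
      N = ⊤ := by
    have h1 (c : ℂ) (w : W) : c ⊗ₜ[ℝ] w ∈ N := by
      obtain ⟨t, rfl⟩ := hirr u hu0 w
      rw [← complexify_smul_tmul, ← mul_one c, ← smul_eq_mul, ← TensorProduct.smul_tmul']
      exact N.smul_mem _ (hsmul N c hN)
    refine (Submodule.eq_top_iff').2 fun z => ?_
    obtain ⟨v, w, rfl⟩ := exists_eq_tmul_add z
    exact add_mem (h1 _ _) (h1 _ _)
  have hne : (1 : ℂ) ⊗ₜ[ℝ] u ≠ 0 := by
    intro h0
    have := congrArg (complexificationMap W) h0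
    rw [complexificationMap_tmul, map_zero] at this
    refine hu0 (Subtype.ext (funext fun y => ?_))
    simpa using congrFun this y
  -- With `t • v = u`, applying `t` and then `F` turns the vector into `(1 + c i) ⊗ u`. Rank one
  -- over `ℝ` makes `c` real, so `1 + c i ≠ 0` and `1 ⊗ u` lies in `N`.
  have hreal (N : Submodule (terwilliger ℂ G x) (ℂ ⊗[ℝ] W)) (v w : W) (hv : v ≠ 0)
      (hz : (1 : ℂ) ⊗ₜ[ℝ] v + Complex.I ⊗ₜ[ℝ] w ∈ N) : N = ⊤ := by
    obtain ⟨t, ht⟩ := hirr v hv u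
    obtain ⟨c, hc⟩ := hF (t • w)
    have h1 := N.smul_mem (complexify F) (N.smul_mem (complexify t) hz)
    rw [smul_add, smul_add, complexify_smul_tmul, complexify_smul_tmul, complexify_smul_tmul,
      complexify_smul_tmul, ht, hu, hc, ← TensorProduct.smul_tmul, ← TensorProduct.add_tmul] at h1
    have hc0 : (1 : ℂ) + c • Complex.I ≠ 0 := fun h => by simpa using congrArg Complex.re h
    have h2 := hsmul N ((1 : ℂ) + c • Complex.I)⁻¹ h1
    rw [TensorProduct.smul_tmul', smul_eq_mul, inv_mul_cancel₀ hc0] at h2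
    exact htop N h2
  have : Nontrivial (ℂ ⊗[ℝ] W) := ⟨⟨_, _, hne⟩⟩
  refine (isSimpleModule_iff _ _).2 ⟨fun N => ?_⟩
  by_cases hN : N = ⊥
  · exact Or.inl hN
  obtain ⟨z, hz, hz0⟩ := (Submodule.ne_bot_iff N).1 hN
  obtain ⟨v, w, rfl⟩ := exists_eq_tmul_add z
  by_cases hv : v = 0
  · have hw : w ≠ 0 := by
      rintro rfl
      simp [hv] at hz0
    -- A purely imaginary vector becomes real after multiplication by `-i`.
    have hz' := hsmul N (-Complex.I) hz
    rw [hv, TensorProduct.tmul_zero, zero_add, TensorProduct.smul_tmul', smul_eq_mul, neg_mul,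
      Complex.I_mul_I, neg_neg] at hz'
    exact Or.inr (hreal N w 0 hw (by simpa using hz'))
  · exact Or.inr (hreal N v w hv hz)

end Irreducible

end QPolyDRG

set_option synthInstance.maxHeartbeats 200000 in
theorem theorem1p3 {X : Type*} [Fintype X] [DecidableEq X]
    (G : SimpleGraph X) [DecidableRel G.Adj]
    (hG : QPolyDRG.IsDistanceRegular G) (hD : 3 ≤ G.diam)
    (E : Fin (G.diam + 1) → Matrix X X ℝ) (hE : QPolyDRG.IsQPolynomialOrdering G E)
    (x : X) (W : Submodule (QPolyDRG.terwilliger ℝ G x) (X → ℝ))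
    (hW : IsSimpleModule (QPolyDRG.terwilliger ℝ G x) W) :
    IsSimpleModule (QPolyDRG.terwilliger ℂ G x) (ℂ ⊗[ℝ] W) := by
  have hirr (v : W) (hv : v ≠ 0) (w : W) : ∃ t : QPolyDRG.terwilliger ℝ G x, t • v = w :=
    IsSimpleModule.toSpanSingleton_surjective (M := W) (QPolyDRG.terwilliger ℝ G x) hv w
  have hnt : Nontrivial W := IsSimpleModule.nontrivial (QPolyDRG.terwilliger ℝ G x) W
  obtain ⟨v, hv⟩ := exists_ne (0 : W)
  let W₀ : Submodule ℝ (X → ℝ) :=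
    { carrier := W
      add_mem' := W.add_mem
      zero_mem' := W.zero_mem
      smul_mem' := fun c v hv => by
        rw [← algebraMap_smul (QPolyDRG.terwilliger ℝ G x) c v]
        exact W.smul_mem _ hv }
  obtain ⟨r, u, huW, hu0, hu, hF⟩ := QPolyDRG.exists_dualIdempotent_mulVec_eq hG (by omega) hE x
    (W := W₀) ((Submodule.ne_bot_iff _).2 ⟨v, v.2, fun h => hv (Subtype.ext h)⟩)
    (fun t ht v hv => W.smul_mem (⟨t, ht⟩ : QPolyDRG.terwilliger ℝ G x) hv)
    (fun u hu hu0 w hw => by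
      obtain ⟨t, ht⟩ := hirr ⟨u, hu⟩ (fun h => hu0 (congrArg Subtype.val h)) ⟨w, hw⟩
      exact ⟨t, t.2, congrArg Subtype.val ht⟩)
  refine QPolyDRG.isSimpleModule_complexification (u := ⟨u, huW⟩)
    (F := ⟨_, QPolyDRG.dualIdempotent_mem_terwilliger hG x r⟩)
    (fun h => hu0 (congrArg Subtype.val h)) (Subtype.ext hu) (fun w => ?_) hirr
  obtain ⟨c, hc⟩ := hF w w.2
  exact ⟨c, Subtype.ext hc⟩
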